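/- Let $f:\mathbb R\to\mathbb R$ be $C^2$ with antiderivative $F$, and let $u$ be a non-constant periodic $C^2$ solution of the travelling-wave equation $$\tfrac12 u_x^2 = E + a u + \tfrac c2 u^2 - F(u),\qquad u_{xx} = a + c u - f(u),$$ with parameters $(a,E,c)\in\mathbb R^3$. Write $R(v;a,E,c)=E+av+\tfrac c2 v^2-F(v)$ and let $$T=\oint \frac{dv}{\sqrt{2R(v;a,E,c)}},\qquad M=\oint \frac{v\,dv}{\sqrt{2R(v;a,E,c)}}$$ be the period and the mass of the wave as functions of the parameters, where $\oint=2\int_{u_-}^{u_+}$ and $(u_-,u_+)$ is the connected component of $\{v: R(v;a,E,c)>0\}$ that contains a fixed value $v_0$ in the interior of the range of $u$. Put $\{T,M\}_{a,E}=T_aM_E-T_EM_a$. Let $k\ge 1$ be an integer, $\mathbb T_k=\mathbb R/(kT\mathbb Z)$, let $\mathcal L=-\partial_x^2-f'(u)+c$ act on the real space $L^2(\mathbb T_k)$ with domain $H^2(\mathbb T_k)$, and let $H_1=\{\phi\in L^2(\mathbb T_k):\langle 1,\phi\rangle=0\}$. Denote by $n(\mathcal L)$ and $n(\mathcal L|_{H_1})$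 the largest dimension of a subspace of $H^2(\mathbb T_k)$, respectively of $H^2(\mathbb T_k)\cap H_1$, on which the quadratic form $\phi\mapsto\langle\phi,\mathcal L\phi\rangle$ is negative definite. Assume $\{T,M\}_{a,E}\ne 0$. Then $n(\mathcal L)$ is finite, and $$n(\mathcal L|_{H_1})=n(\mathcal L)-\begin{cases}0,& T_E\{T,M\}_{a,E}>0,\\ 1,& T_E\{T,M\}_{a,E}<0.\end{cases}$$ -/

import Mathlib

open MeasureTheory

noncomputable section

/-- `u` is a non-constant periodic solution of the travelling-wave equation
`u_x ^ 2 / 2 = E + a u + c u ^ 2 / 2 - F(u)`, together with its differentiated form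
`u_xx = a + c u - f(u)`, where `F` is an antiderivative of the nonlinearity `f`. -/
structure IsPeriodicWave (f F : ℝ → ℝ) (a E c : ℝ) (u : ℝ → ℝ) : Prop where
  antideriv : ∀ v, HasDerivAt F (f v) v
  contDiff : ContDiff ℝ 2 u
  energy : ∀ x, deriv u x ^ 2 / 2 = E + a * u x + c / 2 * u x ^ 2 - F (u x)
  profile : ∀ x, deriv (deriv u) x = a + c * u x - f (u x)
  periodic : ∃ p, 0 < p ∧ Function.Periodic u p
  nonconst : ∃ x y, u x ≠ u y

/-- `R(v; a, E, c) = E + a v + c v ^ 2 / 2 - F(v)`, so that `u_x ^ 2 = 2 R(u)`. -/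
def energyGap (F : ℝ → ℝ) (a E c v : ℝ) : ℝ :=
  E + a * v + c / 2 * v ^ 2 - F v

/-- The interval swept by the oscillation through the value `v₀`: the connected component of
`{v | 0 < R(v; a, E, c)}` containing `v₀`. Its end points are the turning points. -/
def orbitInterval (F : ℝ → ℝ) (v₀ a E c : ℝ) : Set ℝ :=
  connectedComponentIn {v | 0 < energyGap F a E c v} v₀

/-- The period `T(a, E, c) = ∮ du / √(2 R(u; a, E, c))`. The closed loop runs through
the interval between the turning points twice. -/
def wavePeriod (F : ℝ → ℝ) (v₀ a E c : ℝ) : ℝ :=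
  2 * ∫ v in orbitInterval F v₀ a E c, 1 / √(2 * energyGap F a E c v)

/-- The mass `M(a, E, c) = ∮ u du / √(2 R(u; a, E, c))`. -/
def waveMass (F : ℝ → ℝ) (v₀ a E c : ℝ) : ℝ :=
  2 * ∫ v in orbitInterval F v₀ a E c, v / √(2 * energyGap F a E c v)

/-- `T_E`. -/
def periodDerivE (F : ℝ → ℝ) (v₀ a E c : ℝ) : ℝ :=
  deriv (fun E' => wavePeriod F v₀ a E' c) E

/-- The Jacobian determinant `{G, K}_{x, y} = G_x K_y - G_y K_x`. -/
def jacobian₂ (G K : ℝ → ℝ → ℝ) (x y : ℝ) : ℝ :=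
  deriv (fun x' => G x' y) x * deriv (fun y' => K x y') y
    - deriv (fun y' => G x y') y * deriv (fun x' => K x' y) x

/-- `{T, M}_{a, E}`. -/
def periodMassJacobian (F : ℝ → ℝ) (v₀ a E c : ℝ) : ℝ :=
  jacobian₂ (fun a' E' => wavePeriod F v₀ a' E' c) (fun a' E' => waveMass F v₀ a' E' c) a E

/-- The real Hilbert space `L²(ℝ / ℓℤ)`, realized on the fundamental domain `(0, ℓ]`. -/
abbrev L2Per (ℓ : ℝ) : Type := Lp ℝ 2 (volume.restrict (Set.Ioc 0 ℓ))

theorem ae_deriv_add_of_absolutelyContinuous {g h : ℝ → ℝ} {ℓ : ℝ}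
    (hg : AbsolutelyContinuousOnInterval g 0 ℓ) (hh : AbsolutelyContinuousOnInterval h 0 ℓ) :
    deriv (g + h) =ᵐ[volume.restrict (Set.Ioc 0 ℓ)] deriv g + deriv h := by
  rw [Filter.EventuallyEq, ae_restrict_iff' measurableSet_Ioc]
  filter_upwards [hg.ae_differentiableAt, hh.ae_differentiableAt] with x h1 h2 hx
  have hx' : x ∈ Set.uIcc 0 ℓ := Set.Icc_subset_uIcc ⟨hx.1.le, hx.2⟩
  exact deriv_add (h1 hx') (h2 hx')

/-- The second-order Sobolev space `H²(ℝ / ℓℤ)`, through its continuously differentiable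
representatives: the `ℓ`-periodic `C¹` functions whose derivative is absolutely continuous, with
an (almost everywhere defined) second derivative in `L²`. -/
def H2Per (ℓ : ℝ) : Submodule ℝ (ℝ → ℝ) where
  carrier := {w | Function.Periodic w ℓ ∧ ContDiff ℝ 1 w ∧
    AbsolutelyContinuousOnInterval (deriv w) 0 ℓ ∧
    MemLp (deriv (deriv w)) 2 (volume.restrict (Set.Ioc 0 ℓ))}
  zero_mem' := by
    have h : deriv (0 : ℝ → ℝ) = 0 := by funext x; exact deriv_const x (0 : ℝ)
    refine ⟨fun _ => rfl, contDiff_const, ?_, ?_⟩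
    · rw [h]
      exact (contDiff_const (c := (0 : ℝ)) (n := 1)).contDiffOn.absolutelyContinuousOnInterval
    · rw [h, h]; exact MemLp.zero
  add_mem' := by
    rintro v w ⟨hv1, hv2, hv3, hv4⟩ ⟨hw1, hw2, hw3, hw4⟩
    have h : deriv (v + w) = deriv v + deriv w := by
      funext x
      exact deriv_add (hv2.differentiable one_ne_zero x) (hw2.differentiable one_ne_zero x)
    refine ⟨hv1.add hw1, hv2.add hw2, ?_, ?_⟩
    · rw [h]; exact hv3.add hw3
    · rw [h]
      exact (memLp_congr_ae (ae_deriv_add_of_absolutelyContinuous hv3 hw3)).2 (hv4.add hw4)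
  smul_mem' := by
    rintro r w ⟨hw1, hw2, hw3, hw4⟩
    have h : deriv (r • w) = r • deriv w := by
      funext x; exact deriv_const_smul_field r w
    have h' : deriv (r • deriv w) = r • deriv (deriv w) := by
      funext x; exact deriv_const_smul_field r (deriv w)
    refine ⟨fun x => by simp [hw1 x], contDiff_const.smul hw2, ?_, ?_⟩
    · rw [h]; exact hw3.const_smul r
    · rw [h, h']; exact hw4.const_smul r

theorem memLp_restrict_of_continuous {g : ℝ → ℝ} (hg : Continuous g) (ℓ : ℝ) :
    MemLp g 2 (volume.restrict (Set.Ioc 0 ℓ)) := by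
  obtain ⟨C, hC⟩ := (isCompact_Icc (a := (0 : ℝ)) (b := ℓ)).exists_bound_of_continuousOn
    hg.continuousOn
  refine MemLp.of_bound hg.aestronglyMeasurable C ?_
  rw [ae_restrict_iff' measurableSet_Ioc]
  exact Filter.Eventually.of_forall fun x hx => hC x ⟨hx.1.le, hx.2⟩

theorem memLp_schrodinger (V : C(ℝ, ℝ)) {ℓ : ℝ} {w : ℝ → ℝ} (hw : w ∈ H2Per ℓ) :
    MemLp (fun x => -deriv (deriv w) x + V x * w x) 2 (volume.restrict (Set.Ioc 0 ℓ)) :=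
  hw.2.2.2.neg.add (memLp_restrict_of_continuous (V.continuous.mul hw.2.1.continuous) ℓ)

/-- The inclusion of `H²(ℝ / ℓℤ)` into `L²(ℝ / ℓℤ)`. -/
def inclL2 (ℓ : ℝ) : H2Per ℓ →ₗ[ℝ] L2Per ℓ where
  toFun w := (memLp_restrict_of_continuous w.2.2.1.continuous ℓ).toLp
  map_add' _ _ := rfl
  map_smul' _ _ := rfl

/-- The Schrödinger operator `-∂ₓ² + V` on `L²(ℝ / ℓℤ)` with domain `H²(ℝ / ℓℤ)`. -/
def schrodingerOperator (V : C(ℝ, ℝ)) (ℓ : ℝ) : H2Per ℓ →ₗ[ℝ] L2Per ℓ where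
  toFun w := (memLp_schrodinger V w.2).toLp
  map_add' v w := by
    rw [← MemLp.toLp_add, MemLp.toLp_eq_toLp_iff]
    have h : deriv ((v : ℝ → ℝ) + (w : ℝ → ℝ)) =
        deriv (v : ℝ → ℝ) + deriv (w : ℝ → ℝ) := by
      funext x
      exact deriv_add (v.2.2.1.differentiable one_ne_zero x)
        (w.2.2.1.differentiable one_ne_zero x)
    filter_upwards [ae_deriv_add_of_absolutelyContinuous v.2.2.2.1 w.2.2.2.1] with x hx
    simp only [Submodule.coe_add, Pi.add_apply, h, hx]
    ring
  map_smul' r w := by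
    rw [RingHom.id_apply, ← MemLp.toLp_const_smul, MemLp.toLp_eq_toLp_iff]
    have h : deriv (r • (w : ℝ → ℝ)) = r • deriv (w : ℝ → ℝ) := by
      funext x; exact deriv_const_smul_field r (w : ℝ → ℝ)
    have h' : deriv (r • deriv (w : ℝ → ℝ)) = r • deriv (deriv (w : ℝ → ℝ)) := by
      funext x; exact deriv_const_smul_field r (deriv (w : ℝ → ℝ))
    refine Filter.Eventually.of_forall fun x => ?_
    simp only [Submodule.coe_smul, Pi.smul_apply, h, h', smul_eq_mul]
    ring

/-- The linearized operator `𝓛 = -∂ₓ² - f'(u) + c` on `L²(ℝ / ℓℤ)`. -/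
def linearizedOperator {f u : ℝ → ℝ} (hf : ContDiff ℝ 2 f) (hu : ContDiff ℝ 2 u) (c ℓ : ℝ) :
    H2Per ℓ →ₗ[ℝ] L2Per ℓ :=
  schrodingerOperator
    ⟨fun x => -deriv f (u x) + c,
      ((hf.continuous_deriv one_le_two).comp hu.continuous).neg.add continuous_const⟩ ℓ

/-- The mean-zero subspace `H₁ = {φ ∈ L² | ⟪1, φ⟫ = 0}`. -/
def meanZero (ℓ : ℝ) : Submodule ℝ (L2Per ℓ) :=
  (Submodule.span ℝ {Lp.const 2 (volume.restrict (Set.Ioc 0 ℓ)) (1 : ℝ)})ᗮ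

/-- `n(A|_S)` for an operator `A` with domain `H²(ℝ / ℓℤ)` and a subspace `S` of `L²(ℝ / ℓℤ)`:
the largest dimension of a space of functions in the domain of `A`, contained in `S`, on which
the quadratic form `w ↦ ⟪w, A w⟫` is negative definite. The compression of `A` to `S` has the same
quadratic form on `S`; `S = ⊤` gives `n(A)`. -/
def negIndex {ℓ : ℝ} (A : H2Per ℓ →ₗ[ℝ] L2Per ℓ) (S : Submodule ℝ (L2Per ℓ)) : ℕ∞ :=
  ⨆ W : {W : Submodule ℝ (H2Per ℓ) //
      (∀ w ∈ W, inclL2 ℓ w ∈ S) ∧ ∀ w ∈ W, w ≠ 0 → inner ℝ (inclL2 ℓ w) (A w) < 0},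
    Cardinal.toENat (Module.rank ℝ W.1)

end

/-!
Let `R(v) = E + a v + c v² / 2 - F(v)`, so that `u'² = 2 R(u)`, `u'' = R'(u)`, and
`𝓛 = -∂ₓ² + R''(u)`. Differentiating the profile equation in the parameters gives, formally,
`𝓛 u_E = 0` and `𝓛 u_a = -1`. Neither function is periodic: over one period they grow by `-T_E u'`
and `-T_a u'`. These secular terms cancel in `ψ = T_a u_E - T_E u_a`, which is therefore a periodic
solution of `𝓛 ψ = T_E`, and its integral over one period is `{T, M}_{a,E}`.

The count of negative directions follows from `ψ` alone. The form `⟪·, 𝓛 ·⟫` is symmetric and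
`⟪w, 𝓛 ψ⟫ = T_E ∫ w`, so `ψ` is orthogonal for the form to all functions of mean zero, and the
value of the form at `ψ` is `k T_E {T, M}_{a,E}`. If this is positive, projecting along `ψ` onto
the functions of mean zero preserves negative subspaces (`constrainedIndex_eq_of_pos`); if it is
negative, `ψ` is the one negative direction that the constraint removes
(`constrainedIndex_add_one_eq_of_neg`). The index is finite since, by a Poincaré inequality, the
form is nonnegative on functions that vanish at the points of a fine grid
(`negIndex_schrodingerOperator_ne_top`).

To avoid smooth dependence of solutions on parameters, and the moving singularities at the turning
points, everything is expressed through a Bezout relation `α R' + β R = 1`, which holds near the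
range of `u` because the turning points are simple zeros of `R` (`IsHump.exists_bezout`). For a
perturbation `R + e p` it turns `∮ h / √(2(R + e p))`, after an integration by parts, into an
integral of `√(2(R + e p))` against a continuous density, plus `e` times an integral of the
original kind. This is differentiable at `e = 0`, and the derivative is an explicit finite part
`J[p h]` (`IsHump.hasDerivAt_loop_integral`). Hence `T_E = J[1]`, `T_a = M_E = J[v]` and
`M_a = J[v²]`. The same relation regularizes the formal solutions `u' ∫ g(u) / u'²`, for `g = 1`
and `g = v`, of the linearized equation (`variationSolution`). Their increments over a period and
their integrals are again values of `J`, which identifies the constants in the construction of `ψ`.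
-/

open Set Filter Topology

theorem contDiff_one_deriv {g : ℝ → ℝ} (hg : ContDiff ℝ 2 g) : ContDiff ℝ 1 (deriv g) := by
  have : ContDiff ℝ (1 + 1) g := hg
  exact (contDiff_succ_iff_deriv.1 this).2.2

/-! ### Negative index under one linear constraint -/

section Constraint

universe v

variable {X : Type v} [AddCommGroup X] [Module ℝ X] {Y : Type*} [NormedAddCommGroup Y]
  [InnerProductSpace ℝ Y]

/-- The largest dimension of a subspace of `X` that `ι` maps into `S` and on which the quadratic
form `w ↦ ⟪ι w, A w⟫` is negative definite. For `ι = inclL2 ℓ` it is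
`negIndex A S`, by definition. -/
noncomputable def constrainedIndex (ι A : X →ₗ[ℝ] Y) (S : Submodule ℝ Y) : ℕ∞ :=
  ⨆ W : {W : Submodule ℝ X //
      (∀ w ∈ W, ι w ∈ S) ∧ ∀ w ∈ W, w ≠ 0 → inner ℝ (ι w) (A w) < 0},
    Cardinal.toENat (Module.rank ℝ W.1)

variable {ι A : X →ₗ[ℝ] Y} {S : Submodule ℝ Y}

theorem le_constrainedIndex {W : Submodule ℝ X} (hS : ∀ w ∈ W, ι w ∈ S)
    (hW : ∀ w ∈ W, w ≠ 0 → inner ℝ (ι w) (A w) < 0) :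
    Cardinal.toENat (Module.rank ℝ W) ≤ constrainedIndex ι A S :=
  le_iSup (fun W : {W : Submodule ℝ X //
      (∀ w ∈ W, ι w ∈ S) ∧ ∀ w ∈ W, w ≠ 0 → inner ℝ (ι w) (A w) < 0} =>
      Cardinal.toENat (Module.rank ℝ W.1)) ⟨W, hS, hW⟩

theorem constrainedIndex_le {n : ℕ∞}
    (h : ∀ W : Submodule ℝ X, (∀ w ∈ W, ι w ∈ S) →
      (∀ w ∈ W, w ≠ 0 → inner ℝ (ι w) (A w) < 0) →
      Cardinal.toENat (Module.rank ℝ W) ≤ n) : constrainedIndex ι A S ≤ n :=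
  iSup_le fun W => h W.1 W.2.1 W.2.2

/-- If every `w` in the domain that satisfies `N` linear conditions has `⟪ι w, A w⟫ ≥ 0`, then the
negative index is at most `N`. -/
theorem constrainedIndex_ne_top_of_nonneg_on_ker {N : ℕ} (ev : X →ₗ[ℝ] (Fin N → ℝ))
    (h : ∀ w, ev w = 0 → 0 ≤ inner ℝ (ι w) (A w)) : constrainedIndex ι A S ≠ ⊤ := by
  refine ne_top_of_le_ne_top (ENat.natCast_ne_top N) (constrainedIndex_le fun W _ hW => ?_)
  have hinj : Function.Injective (ev.domRestrict W) := by
    rw [← LinearMap.ker_eq_bot, LinearMap.ker_eq_bot']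
    intro w hw
    by_contra hne
    exact (h w.1 hw).not_gt (hW w.1 w.2 fun h0 => hne (Subtype.ext h0))
  have hr := LinearMap.lift_rank_le_of_injective _ hinj
  rw [rank_fin_fun, Cardinal.lift_natCast] at hr
  simpa using OrderHomClass.mono Cardinal.toENat hr

variable {μ : X →ₗ[ℝ] ℝ} {ψ : X} {τ : ℝ}

theorem quadratic_expansion (h₁ : ∀ w, inner ℝ (ι w) (A ψ) = τ * μ w)
    (h₂ : ∀ w, inner ℝ (ι ψ) (A w) = τ * μ w) (w : X) (t : ℝ) :
    inner ℝ (ι (w + t • ψ)) (A (w + t • ψ)) =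
      inner ℝ (ι w) (A w) + 2 * t * (τ * μ w) + t ^ 2 * (τ * μ ψ) := by
  simp only [map_add, map_smul, inner_add_left, inner_add_right, real_inner_smul_left,
    real_inner_smul_right, h₁, h₂]
  ring

/-- If `ψ` is orthogonal to the constrained space for the form of `A`, and the form is positive at
`ψ`, then projecting along `ψ` does not increase the form, and the constraint costs nothing. -/
theorem constrainedIndex_eq_of_pos (hS : ∀ w, ι w ∈ S ↔ μ w = 0)
    (h₁ : ∀ w, inner ℝ (ι w) (A ψ) = τ * μ w)
    (h₂ : ∀ w, inner ℝ (ι ψ) (A w) = τ * μ w) (hψ : 0 < τ * μ ψ) :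
    constrainedIndex ι A S = constrainedIndex ι A ⊤ := by
  have hμ : μ ψ ≠ 0 := fun h => by simp [h] at hψ
  refine le_antisymm (constrainedIndex_le fun _ _ hW =>
    le_constrainedIndex (fun _ _ => Submodule.mem_top) hW) (constrainedIndex_le fun W _ hW => ?_)
  set P : X →ₗ[ℝ] X := LinearMap.id - (μ.smulRight ((μ ψ)⁻¹ • ψ)) with hP
  have hPw : ∀ w, P w = w + (-(μ w / μ ψ)) • ψ := fun w => by
    simp [hP, smul_smul, div_eq_mul_inv, sub_eq_add_neg]
  have hμP : ∀ w, μ (P w) = 0 := fun w => by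
    rw [hPw, map_add, map_smul, smul_eq_mul]
    field_simp
    ring
  have hle : ∀ w, inner ℝ (ι (P w)) (A (P w)) ≤ inner ℝ (ι w) (A w) := by
    intro w
    have h3 := quadratic_expansion h₁ h₂ (P w) (μ w / μ ψ)
    rw [hμP] at h3
    have h4 : P w + (μ w / μ ψ) • ψ = w := by rw [hPw, neg_smul]; abel
    rw [h4] at h3
    have := mul_nonneg (sq_nonneg (μ w / μ ψ)) hψ.le
    linarith
  have hinj : Function.Injective (P.domRestrict W) := by
    rw [← LinearMap.ker_eq_bot, LinearMap.ker_eq_bot']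
    intro w hw
    by_contra hne
    have h5 := hle w.1
    rw [show P w.1 = 0 from hw] at h5
    simp only [map_zero, inner_zero_left] at h5
    exact h5.not_gt (hW w.1 w.2 fun h0 => hne (Subtype.ext h0))
  have hrank := (LinearEquiv.ofInjective _ hinj).rank_eq
  rw [hrank]
  refine le_constrainedIndex ?_ ?_
  · rintro _ ⟨w, rfl⟩
    exact (hS _).2 (hμP w)
  · rintro _ ⟨w, rfl⟩ hne
    refine (hle w.1).trans_lt (hW w.1 w.2 fun h0 => hne ?_)
    rw [LinearMap.domRestrict_apply, h0, map_zero]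

/-- If `ψ` is orthogonal to the constrained space for the form of `A`, and the form is negative at
`ψ`, then `ψ` is the one negative direction that the constraint removes. -/
theorem constrainedIndex_add_one_eq_of_neg (hS : ∀ w, ι w ∈ S ↔ μ w = 0)
    (h₁ : ∀ w, inner ℝ (ι w) (A ψ) = τ * μ w)
    (h₂ : ∀ w, inner ℝ (ι ψ) (A w) = τ * μ w) (hψ : τ * μ ψ < 0) :
    constrainedIndex ι A S + 1 = constrainedIndex ι A ⊤ := by
  have hμ : μ ψ ≠ 0 := fun h => by simp [h] at hψ
  have hψ0 : ψ ≠ 0 := fun h => hμ (by rw [h, map_zero])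
  refine le_antisymm ?_ (constrainedIndex_le fun W _ hW => ?_)
  · have : Nonempty {W : Submodule ℝ X //
      (∀ w ∈ W, ι w ∈ S) ∧ ∀ w ∈ W, w ≠ 0 → inner ℝ (ι w) (A w) < 0} := by
      refine ⟨⟨⊥, fun w hw => ?_, fun w hw h => absurd ((Submodule.mem_bot ℝ).1 hw) h⟩⟩
      rw [(Submodule.mem_bot ℝ).1 hw, map_zero]
      exact S.zero_mem
    rw [constrainedIndex, ENat.iSup_add]
    refine iSup_le fun W => ?_
    obtain ⟨W, hWS, hW⟩ := W
    have hinf : W ⊓ Submodule.span ℝ {ψ} = ⊥ := by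
      rw [eq_bot_iff]
      rintro w ⟨hw, hw'⟩
      obtain ⟨t, rfl⟩ := Submodule.mem_span_singleton.1 hw'
      have h3 := (hS _).1 (hWS _ hw)
      rw [map_smul, smul_eq_mul, mul_eq_zero, or_iff_left hμ] at h3
      simp [h3]
    have hsum := Submodule.rank_sup_add_rank_inf_eq W (Submodule.span ℝ {ψ})
    rw [hinf, rank_bot, add_zero,
      Module.rank_eq_one_iff_finrank_eq_one.2 (finrank_span_singleton hψ0)] at hsum
    have h4 : Cardinal.toENat (Module.rank ℝ W) + 1 =
        Cardinal.toENat (Module.rank ℝ ↥(W ⊔ Submodule.span ℝ {ψ})) := by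
      rw [hsum, map_add, map_one]
    rw [h4]
    refine le_constrainedIndex (fun _ _ => Submodule.mem_top) ?_
    intro w hw hne
    obtain ⟨y, hy, z, hz, rfl⟩ := Submodule.mem_sup.1 hw
    obtain ⟨t, rfl⟩ := Submodule.mem_span_singleton.1 hz
    rw [quadratic_expansion h₁ h₂, (hS _).1 (hWS y hy), mul_zero, mul_zero, add_zero]
    by_cases hy0 : y = 0
    · have ht : t ≠ 0 := fun h => hne (by rw [hy0, h]; simp)
      rw [hy0]
      simp only [map_zero, inner_zero_left, zero_add]
      exact mul_neg_of_pos_of_neg (by positivity) hψ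
    · have := hW y hy hy0
      have := mul_nonpos_of_nonneg_of_nonpos (sq_nonneg t) hψ.le
      linarith
  · have h3 := LinearMap.lift_rank_range_add_rank_ker (μ.domRestrict W)
    have h4 : Module.rank ℝ (LinearMap.ker (μ.domRestrict W)) =
        Module.rank ℝ ((LinearMap.ker (μ.domRestrict W)).map W.subtype) :=
      ((LinearMap.ker (μ.domRestrict W)).equivMapOfInjective _ W.injective_subtype).rank_eq
    have h5 : Module.rank ℝ (LinearMap.range (μ.domRestrict W)) ≤ 1 :=
      (Submodule.rank_le _).trans_eq (Module.rank_self ℝ)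
    have h6 : Cardinal.toENat (Module.rank ℝ (LinearMap.ker (μ.domRestrict W))) ≤
        constrainedIndex ι A S := by
      rw [h4]
      refine le_constrainedIndex ?_ ?_
      · rintro _ ⟨w, hw, rfl⟩
        exact (hS _).2 hw
      · rintro _ ⟨w, -, rfl⟩ hne
        exact hW _ w.2 hne
    have h7 := congrArg Cardinal.toENat h3
    rw [map_add, Cardinal.toENat_lift, Cardinal.toENat_lift, Cardinal.toENat_lift] at h7
    rw [← h7, add_comm]
    exact add_le_add h6 (by simpa using OrderHomClass.mono Cardinal.toENat h5)

end Constraint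

/-! ### Schrödinger operators on the circle -/

theorem inner_schrodingerOperator (V : C(ℝ, ℝ)) {ℓ : ℝ} (hℓ : 0 ≤ ℓ) (w z : H2Per ℓ) :
    inner ℝ (inclL2 ℓ w) (schrodingerOperator V ℓ z) =
      ∫ x in 0..ℓ, w.1 x * (-deriv (deriv z.1) x + V x * z.1 x) := by
  rw [L2.inner_def, intervalIntegral.integral_of_le hℓ]
  refine integral_congr_ae ?_
  filter_upwards [(memLp_restrict_of_continuous w.2.2.1.continuous ℓ).coeFn_toLp,
    (memLp_schrodinger V z.2).coeFn_toLp] with x h1 h2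
  have e1 : (inclL2 ℓ w) x = w.1 x := h1
  have e2 : (schrodingerOperator V ℓ z) x = -deriv (deriv z.1) x + V x * z.1 x := h2
  rw [e1, e2]
  simp [mul_comm]

theorem inner_schrodingerOperator_eq_form (V : C(ℝ, ℝ)) {ℓ : ℝ} (hℓ : 0 ≤ ℓ) (w z : H2Per ℓ) :
    inner ℝ (inclL2 ℓ w) (schrodingerOperator V ℓ z) =
      ∫ x in 0..ℓ, (deriv w.1 x * deriv z.1 x + V x * (w.1 x * z.1 x)) := by
  rw [inner_schrodingerOperator V hℓ]
  have hw := w.2.2.1.continuous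
  have hz := z.2.2.1.continuous
  have hw' := w.2.2.1.continuous_deriv le_rfl
  have hz' := z.2.2.1.continuous_deriv le_rfl
  have hVc := V.continuous
  have hper : deriv z.1 ℓ = deriv z.1 0 := by
    have := deriv_comp_add_const z.1 ℓ 0
    rw [zero_add, show (fun x => z.1 (x + ℓ)) = z.1 from funext z.2.1] at this
    exact this.symm
  have hper' : w.1 ℓ = w.1 0 := by simpa using w.2.1 0
  have hibp := AbsolutelyContinuousOnInterval.integral_mul_deriv_eq_deriv_mul
    (w.2.2.1.contDiffOn.absolutelyContinuousOnInterval (a := 0) (b := ℓ)) z.2.2.2.1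
  rw [hper, hper', sub_self, zero_sub] at hibp
  have hint : IntervalIntegrable (deriv (deriv z.1)) volume 0 ℓ := by
    rw [intervalIntegrable_iff_integrableOn_Ioc_of_le hℓ]
    exact z.2.2.2.2.integrable (by norm_num)
  have hi₁ : IntervalIntegrable (fun x => w.1 x * deriv (deriv z.1) x) volume 0 ℓ :=
    hint.continuousOn_mul hw.continuousOn
  have hi₂ : IntervalIntegrable (fun x => V x * (w.1 x * z.1 x)) volume 0 ℓ :=
    Continuous.intervalIntegrable (by fun_prop) _ _
  have hi₃ : IntervalIntegrable (fun x => deriv w.1 x * deriv z.1 x) volume 0 ℓ :=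
    Continuous.intervalIntegrable (by fun_prop) _ _
  rw [intervalIntegral.integral_add hi₃ hi₂]
  have : ∀ x, w.1 x * (-deriv (deriv z.1) x + V x * z.1 x) =
      -(w.1 x * deriv (deriv z.1) x) + V x * (w.1 x * z.1 x) := fun x => by ring
  simp_rw [this]
  have hi₁' : IntervalIntegrable (fun x => -(w.1 x * deriv (deriv z.1) x)) volume 0 ℓ := hi₁.neg
  rw [intervalIntegral.integral_add hi₁' hi₂, intervalIntegral.integral_neg, hibp, neg_neg]

theorem inclL2_mem_meanZero_iff {ℓ : ℝ} (hℓ : 0 ≤ ℓ) (w : H2Per ℓ) :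
    inclL2 ℓ w ∈ meanZero ℓ ↔ ∫ x in 0..ℓ, w.1 x = 0 := by
  rw [meanZero, Submodule.mem_orthogonal_singleton_iff_inner_right, L2.inner_def,
    intervalIntegral.integral_of_le hℓ]
  refine Eq.congr_left (integral_congr_ae ?_)
  filter_upwards [(memLp_restrict_of_continuous w.2.2.1.continuous ℓ).coeFn_toLp,
    Lp.coeFn_const (p := 2) (μ := volume.restrict (Ioc 0 ℓ)) (1 : ℝ)] with x h1 h2
  have e1 : (inclL2 ℓ w) x = w.1 x := h1
  rw [e1, h2]
  simp

/-- The integral over the circle, as a linear functional. -/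
noncomputable def circleIntegralPer (ℓ : ℝ) : H2Per ℓ →ₗ[ℝ] ℝ where
  toFun w := ∫ x in 0..ℓ, w.1 x
  map_add' v w := intervalIntegral.integral_add
    (v.2.2.1.continuous.intervalIntegrable _ _) (w.2.2.1.continuous.intervalIntegrable _ _)
  map_smul' r _ := intervalIntegral.integral_const_mul r _

/-- A one-dimensional Poincaré inequality for functions that vanish at the left end point. -/
theorem sq_le_mul_integral_deriv_sq {w : ℝ → ℝ} (hw : ContDiff ℝ 1 w) {s x : ℝ} (hsx : s ≤ x)
    (h0 : w s = 0) : w x ^ 2 ≤ (x - s) * ∫ y in s..x, deriv w y ^ 2 := by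
  rcases hsx.eq_or_lt with rfl | hlt
  · simp [h0]
  have hw' := hw.continuous_deriv le_rfl
  have hftc : ∫ y in s..x, deriv w y = w x := by
    rw [intervalIntegral.integral_deriv_eq_sub
      (fun y _ => hw.differentiable one_ne_zero y) (hw'.intervalIntegrable _ _), h0, sub_zero]
  have hpos : 0 < x - s := sub_pos.2 hlt
  -- The variance of `w'` over `[s, x]` is nonnegative.
  have hvar : 0 ≤ ∫ y in s..x, (deriv w y - w x / (x - s)) ^ 2 :=
    intervalIntegral.integral_nonneg hsx fun y _ => sq_nonneg _
  have hexp : ∀ y, (deriv w y - w x / (x - s)) ^ 2 =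
      deriv w y ^ 2 - 2 * (w x / (x - s)) * deriv w y + (w x / (x - s)) ^ 2 := fun y => by ring
  have hi₁ : IntervalIntegrable (fun y => deriv w y ^ 2) volume s x :=
    (hw'.pow 2).intervalIntegrable _ _
  have hi₂ : IntervalIntegrable (fun y => 2 * (w x / (x - s)) * deriv w y) volume s x :=
    (hw'.const_mul _).intervalIntegrable _ _
  simp_rw [hexp] at hvar
  rw [intervalIntegral.integral_add (hi₁.sub hi₂) (by simp), intervalIntegral.integral_sub hi₁ hi₂,
    intervalIntegral.integral_const_mul, hftc, intervalIntegral.integral_const, smul_eq_mul] at hvar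
  have : (∫ y in s..x, deriv w y ^ 2) - 2 * (w x / (x - s)) * w x +
      (x - s) * (w x / (x - s)) ^ 2 = (∫ y in s..x, deriv w y ^ 2) - w x ^ 2 / (x - s) := by
    field_simp
    ring
  rw [this, sub_nonneg, div_le_iff₀ hpos] at hvar
  linarith

theorem form_nonneg_of_short_interval {w V : ℝ → ℝ} (hw : ContDiff ℝ 1 w) (hV : Continuous V)
    {s t C : ℝ} (hst : s ≤ t) (h0 : w s = 0) (hC : 0 ≤ C) (hVC : ∀ x ∈ Icc s t, -C ≤ V x)
    (hsmall : C * (t - s) ^ 2 ≤ 1) :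
    0 ≤ ∫ x in s..t, (deriv w x * deriv w x + V x * (w x * w x)) := by
  have hw' := hw.continuous_deriv le_rfl
  have hwc := hw.continuous
  set I := ∫ y in s..t, deriv w y ^ 2 with hI
  have hI0 : 0 ≤ I := intervalIntegral.integral_nonneg hst fun y _ => sq_nonneg _
  have hwI : ∀ x ∈ Icc s t, w x ^ 2 ≤ (t - s) * I := by
    intro x hx
    refine (sq_le_mul_integral_deriv_sq hw hx.1 h0).trans ?_
    have hmono : ∫ y in s..x, deriv w y ^ 2 ≤ I :=
      intervalIntegral.integral_mono_interval le_rfl hx.1 hx.2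
        (Eventually.of_forall fun y => sq_nonneg _) ((hw'.pow 2).intervalIntegrable _ _)
    have h1 : 0 ≤ ∫ y in s..x, deriv w y ^ 2 :=
      intervalIntegral.integral_nonneg hx.1 fun y _ => sq_nonneg _
    exact mul_le_mul (by linarith [hx.2]) hmono h1 (by linarith)
  have hi₁ : IntervalIntegrable (fun y => deriv w y ^ 2) volume s t :=
    (hw'.pow 2).intervalIntegrable _ _
  have hle : ∫ x in s..t, (deriv w x ^ 2 - C * ((t - s) * I)) ≤
      ∫ x in s..t, (deriv w x * deriv w x + V x * (w x * w x)) := by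
    refine intervalIntegral.integral_mono_on hst (hi₁.sub (by simp))
      (Continuous.intervalIntegrable (by fun_prop) _ _) fun x hx => ?_
    have h1 := hwI x hx
    have h2 := hVC x hx
    nlinarith [mul_le_mul_of_nonneg_left h1 hC, mul_nonneg (sub_nonneg.2 h2) (sq_nonneg (w x))]
  refine le_trans ?_ hle
  rw [intervalIntegral.integral_sub hi₁ (by simp), intervalIntegral.integral_const, smul_eq_mul,
    ← hI]
  nlinarith [mul_le_mul_of_nonneg_right hsmall hI0]

/-- A function that vanishes at the points of a fine enough grid has a nonnegative quadratic form,
so that the negative index is at most the number of grid points. -/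
theorem negIndex_schrodingerOperator_ne_top (V : C(ℝ, ℝ)) {ℓ : ℝ} (hℓ : 0 < ℓ) :
    negIndex (schrodingerOperator V ℓ) ⊤ ≠ ⊤ := by
  obtain ⟨C, hC⟩ := (isCompact_Icc (a := (0 : ℝ)) (b := ℓ)).exists_bound_of_continuousOn
    V.continuous.continuousOn
  have hC0 : 0 ≤ C := (norm_nonneg _).trans (hC 0 ⟨le_rfl, hℓ.le⟩)
  obtain ⟨N, hN⟩ := exists_nat_ge (C * ℓ ^ 2 + 1)
  have hN1 : (1 : ℝ) ≤ N := le_trans (by nlinarith [mul_nonneg hC0 (sq_nonneg ℓ)]) hN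
  have hN0 : (0 : ℝ) < N := by linarith
  set g : ℕ → ℝ := fun i => i * (ℓ / N) with hg
  have hstep : ∀ i, g (i + 1) - g i = ℓ / N := fun i => by simp only [hg]; push_cast; ring
  let ev : H2Per ℓ →ₗ[ℝ] (Fin N → ℝ) :=
    { toFun := fun w i => w.1 (g i)
      map_add' := fun _ _ => rfl
      map_smul' := fun _ _ => rfl }
  refine constrainedIndex_ne_top_of_nonneg_on_ker (ι := inclL2 ℓ) (S := ⊤) ev fun w hw => ?_
  rw [inner_schrodingerOperator_eq_form V hℓ.le]
  have hw' := w.2.2.1.continuous_deriv le_rfl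
  have hwc := w.2.2.1.continuous
  have hVc := V.continuous
  have hsum := intervalIntegral.sum_integral_adjacent_intervals (μ := volume) (a := g) (n := N)
    (f := fun x => deriv w.1 x * deriv w.1 x + V x * (w.1 x * w.1 x))
    (fun i _ => Continuous.intervalIntegrable (by fun_prop) _ _)
  rw [show g 0 = 0 by simp [hg], show g N = ℓ by simp only [hg]; field_simp] at hsum
  rw [← hsum]
  refine Finset.sum_nonneg fun i hi => ?_
  have hiN : i < N := Finset.mem_range.1 hi
  have hd : 0 < ℓ / N := by positivity
  have hle : g i ≤ g (i + 1) := by linarith [hstep i]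
  refine form_nonneg_of_short_interval w.2.2.1 hVc hle (congrFun hw ⟨i, hiN⟩) hC0 ?_ ?_
  · intro x hx
    have h0 : 0 ≤ g i := by simp only [hg]; positivity
    have h1 : g (i + 1) ≤ ℓ := by
      have : ((i + 1 : ℕ) : ℝ) ≤ N := by exact_mod_cast hiN
      calc g (i + 1) ≤ N * (ℓ / N) := by
            simp only [hg]
            exact mul_le_mul_of_nonneg_right this hd.le
        _ = ℓ := by field_simp
    exact (abs_le.1 (hC x ⟨h0.trans hx.1, hx.2.trans h1⟩)).1
  · rw [hstep, div_pow, ← mul_div_assoc, div_le_one (by positivity)]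
    nlinarith

theorem mem_H2Per_of_contDiff {ℓ : ℝ} {ψ : ℝ → ℝ} (hper : Function.Periodic ψ ℓ)
    (hψ : ContDiff ℝ 2 ψ) : ψ ∈ H2Per ℓ := by
  have h1 : ContDiff ℝ 1 (deriv ψ) := contDiff_one_deriv hψ
  exact ⟨hper, hψ.of_le one_le_two, h1.contDiffOn.absolutelyContinuousOnInterval,
    memLp_restrict_of_continuous (h1.continuous_deriv le_rfl) ℓ⟩

/-- A solution `ψ` of `-ψ'' + V ψ = τ` on the circle decides how the negative index changes under
restriction to functions of mean zero: `ψ` is orthogonal to them for the quadratic form, whose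
value at `ψ` is `τ ∫ ψ`. -/
theorem negIndex_meanZero (V : C(ℝ, ℝ)) {ℓ τ : ℝ} (hℓ : 0 < ℓ) {ψ : ℝ → ℝ}
    (hper : Function.Periodic ψ ℓ) (hψ : ContDiff ℝ 2 ψ)
    (heq : ∀ x, -deriv (deriv ψ) x + V x * ψ x = τ) :
    (0 < τ * ∫ x in 0..ℓ, ψ x →
      negIndex (schrodingerOperator V ℓ) (meanZero ℓ) = negIndex (schrodingerOperator V ℓ) ⊤) ∧
    (τ * ∫ x in 0..ℓ, ψ x < 0 →
      negIndex (schrodingerOperator V ℓ) (meanZero ℓ) + 1 =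
        negIndex (schrodingerOperator V ℓ) ⊤) := by
  let Ψ : H2Per ℓ := ⟨ψ, mem_H2Per_of_contDiff hper hψ⟩
  have h₁ : ∀ w, inner ℝ (inclL2 ℓ w) (schrodingerOperator V ℓ Ψ) =
      τ * circleIntegralPer ℓ w := by
    intro w
    rw [inner_schrodingerOperator V hℓ.le]
    have : ∀ x, w.1 x * (-deriv (deriv Ψ.1) x + V x * Ψ.1 x) = τ * w.1 x := fun x => by
      rw [heq x, mul_comm]
    simp_rw [this]
    exact intervalIntegral.integral_const_mul _ _
  have h₂ : ∀ w, inner ℝ (inclL2 ℓ Ψ) (schrodingerOperator V ℓ w) =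
      τ * circleIntegralPer ℓ w := by
    intro w
    rw [← h₁, inner_schrodingerOperator_eq_form V hℓ.le, inner_schrodingerOperator_eq_form V hℓ.le]
    refine intervalIntegral.integral_congr fun x _ => ?_
    ring
  exact ⟨fun h => constrainedIndex_eq_of_pos (inclL2_mem_meanZero_iff hℓ.le) h₁ h₂ h,
    fun h => constrainedIndex_add_one_eq_of_neg (inclL2_mem_meanZero_iff hℓ.le) h₁ h₂ h⟩

/-! ### Differentiating integrals with an inverse square root singularity -/

/-- `Q` has a single positive hump on `[p₁, p₄]`: it crosses zero upwards with slope at least `m`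
on `[p₁, p₂]`, is positive on `[p₂, p₃]`, and crosses zero downwards on `[p₃, p₄]`. The condition is
open in `Q` for the `C¹` topology, so it persists under small changes of the parameters. -/
structure IsHump (Q : ℝ → ℝ) (p₁ p₂ p₃ p₄ m : ℝ) : Prop where
  contDiff : ContDiff ℝ 1 Q
  slope_pos : 0 < m
  lt₁₂ : p₁ < p₂
  le₂₃ : p₂ ≤ p₃
  lt₃₄ : p₃ < p₄
  left : ∀ v ∈ Icc p₁ p₂, m ≤ deriv Q v
  right : ∀ v ∈ Icc p₃ p₄, deriv Q v ≤ -m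
  mid : ∀ v ∈ Icc p₂ p₃, 0 < Q v
  neg₁ : Q p₁ < 0
  neg₄ : Q p₄ < 0

theorem integrableOn_inv_sqrt_of_linear_bound {Q : ℝ → ℝ} {s t z m : ℝ} (hQ : Continuous Q)
    (hm : 0 < m) (h : ∀ v ∈ Icc s t, m * |v - z| ≤ |Q v|) :
    IntegrableOn (fun v => 1 / √|Q v|) (Icc s t) := by
  rcases lt_or_ge t s with hst | hst
  · simp [Icc_eq_empty (not_le.2 hst)]
  have h1 : IntervalIntegrable (fun v : ℝ => |v - z| ^ (-(1 / 2) : ℝ)) volume s t := by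
    have h0 : ∀ a : ℝ, IntervalIntegrable (fun v : ℝ => |v| ^ (-(1 / 2) : ℝ)) volume 0 a := by
      have hp : ∀ a : ℝ, 0 ≤ a →
          IntervalIntegrable (fun v : ℝ => |v| ^ (-(1 / 2) : ℝ)) volume 0 a := by
        intro a ha
        refine (intervalIntegral.intervalIntegrable_rpow' (a := 0) (b := a)
          (r := -(1 / 2)) (by norm_num)).congr ?_
        intro v hv
        rw [uIoc_of_le ha] at hv
        simp only [abs_of_pos hv.1]
      intro a
      rcases le_total 0 a with ha | ha
      · exact hp a ha
      · have := (hp (-a) (by linarith)).comp_sub_left 0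
        simpa [abs_neg] using this
    exact ((h0 (s - z)).symm.trans (h0 (t - z))).comp_sub_right z |>.congr_ae
      (by simp) |> fun h => by simpa using h
  rw [intervalIntegrable_iff_integrableOn_Icc_of_le hst] at h1
  refine (h1.const_mul (1 / √m)).mono' ?_ ?_
  · exact (measurable_const.div (hQ.measurable.abs.sqrt)).aestronglyMeasurable
  · rw [ae_restrict_iff' measurableSet_Icc]
    have hz : ∀ᵐ v : ℝ, v ≠ z := by simp [ae_iff]
    filter_upwards [hz] with v hvz hv
    have hpos : 0 < |v - z| := abs_pos.2 (sub_ne_zero.2 hvz)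
    have h2 := Real.sqrt_le_sqrt (h v hv)
    rw [Real.sqrt_mul hm.le] at h2
    rw [Real.rpow_neg hpos.le, ← Real.sqrt_eq_rpow, Real.norm_of_nonneg (by positivity),
      ← one_div, one_div_mul_one_div]
    exact one_div_le_one_div_of_le (by positivity) h2

theorem connectedComponentIn_pos_eq_Ioo {Q : ℝ → ℝ} {v₀ z₁ z₂ : ℝ} (h₁ : Q z₁ = 0) (h₂ : Q z₂ = 0)
    (hpos : ∀ v ∈ Ioo z₁ z₂, 0 < Q v) (hv₀ : v₀ ∈ Ioo z₁ z₂) :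
    connectedComponentIn {v | 0 < Q v} v₀ = Ioo z₁ z₂ := by
  refine Subset.antisymm ?_ (isPreconnected_Ioo.subset_connectedComponentIn hv₀ hpos)
  have hsub := connectedComponentIn_subset {v | 0 < Q v} v₀
  have hoc : (connectedComponentIn {v | 0 < Q v} v₀).OrdConnected :=
    isPreconnected_connectedComponentIn.ordConnected
  have hmem : v₀ ∈ connectedComponentIn {v | 0 < Q v} v₀ :=
    mem_connectedComponentIn (hpos v₀ hv₀)
  intro v hv
  by_contra hn
  simp only [mem_Ioo, not_and_or, not_lt] at hn
  rcases hn with h | h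
  · exact (hsub (hoc.out hv hmem ⟨h, hv₀.1.le⟩)).ne' h₁
  · exact (hsub (hoc.out hmem hv ⟨hv₀.2.le, h⟩)).ne' h₂

namespace IsHump

variable {Q : ℝ → ℝ} {p₁ p₂ p₃ p₄ m : ℝ}

theorem lt₁₄ (H : IsHump Q p₁ p₂ p₃ p₄ m) : p₁ < p₄ :=
  H.lt₁₂.trans_le (H.le₂₃.trans H.lt₃₄.le)

theorem increment_left (H : IsHump Q p₁ p₂ p₃ p₄ m) {x y : ℝ} (hx : p₁ ≤ x) (hxy : x ≤ y)
    (hy : y ≤ p₂) : m * (y - x) ≤ Q y - Q x :=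
  (convex_Icc p₁ p₂).mul_sub_le_image_sub_of_le_deriv H.contDiff.continuous.continuousOn
    (H.contDiff.differentiable one_ne_zero).differentiableOn
    (fun v hv => H.left v (interior_subset hv)) x ⟨hx, hxy.trans hy⟩ y ⟨hx.trans hxy, hy⟩ hxy

theorem increment_right (H : IsHump Q p₁ p₂ p₃ p₄ m) {x y : ℝ} (hx : p₃ ≤ x) (hxy : x ≤ y)
    (hy : y ≤ p₄) : Q y - Q x ≤ -m * (y - x) :=
  (convex_Icc p₃ p₄).image_sub_le_mul_sub_of_deriv_le H.contDiff.continuous.continuousOn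
    (H.contDiff.differentiable one_ne_zero).differentiableOn
    (fun v hv => H.right v (interior_subset hv)) x ⟨hx, hxy.trans hy⟩ y ⟨hx.trans hxy, hy⟩ hxy

theorem exists_left_zero (H : IsHump Q p₁ p₂ p₃ p₄ m) :
    ∃ z ∈ Ioo p₁ p₂, Q z = 0 := by
  have := intermediate_value_Ioo H.lt₁₂.le (H.contDiff.continuous.continuousOn (s := Icc p₁ p₂))
  exact this ⟨H.neg₁, H.mid p₂ ⟨le_rfl, H.le₂₃⟩⟩

theorem exists_right_zero (H : IsHump Q p₁ p₂ p₃ p₄ m) :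
    ∃ z ∈ Ioo p₃ p₄, Q z = 0 := by
  have := intermediate_value_Ioo' H.lt₃₄.le (H.contDiff.continuous.continuousOn (s := Icc p₃ p₄))
  exact this ⟨H.neg₄, H.mid p₃ ⟨H.le₂₃, le_rfl⟩⟩

/-- The turning points, and the sign of `Q` on the intervals that they cut out. -/
theorem exists_turning_points (H : IsHump Q p₁ p₂ p₃ p₄ m) :
    ∃ z₁ ∈ Ioo p₁ p₂, ∃ z₂ ∈ Ioo p₃ p₄, Q z₁ = 0 ∧ Q z₂ = 0 ∧
      (∀ v ∈ Ico p₁ z₁, Q v < 0) ∧ (∀ v ∈ Ioo z₁ z₂, 0 < Q v) ∧ (∀ v ∈ Ioc z₂ p₄, Q v < 0) := by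
  obtain ⟨z₁, hz₁, h₁⟩ := H.exists_left_zero
  obtain ⟨z₂, hz₂, h₂⟩ := H.exists_right_zero
  have hm := H.slope_pos
  refine ⟨z₁, hz₁, z₂, hz₂, h₁, h₂, fun v hv => ?_, fun v hv => ?_, fun v hv => ?_⟩
  · have := H.increment_left hv.1 hv.2.le hz₁.2.le
    have := mul_pos hm (sub_pos.2 hv.2)
    linarith
  · rcases le_total v p₂ with h | h
    · have := H.increment_left hz₁.1.le hv.1.le h
      have := mul_pos hm (sub_pos.2 hv.1)
      linarith
    · rcases le_total v p₃ with h' | h'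
      · exact H.mid v ⟨h, h'⟩
      · have := H.increment_right h' hv.2.le hz₂.2.le
        have := mul_pos hm (sub_pos.2 hv.2)
        linarith
  · have := H.increment_right hz₂.1.le hv.1.le hv.2
    have := mul_pos hm (sub_pos.2 hv.1)
    linarith

theorem countable_zeros (H : IsHump Q p₁ p₂ p₃ p₄ m) :
    ({v ∈ Icc p₁ p₄ | Q v = 0}).Countable := by
  obtain ⟨z₁, -, z₂, -, -, -, hl, hm, hr⟩ := H.exists_turning_points
  refine (Set.toFinite {z₁, z₂}).countable.mono ?_
  rintro v ⟨hv, h0⟩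
  by_contra hne
  simp only [mem_insert_iff, mem_singleton_iff, not_or] at hne
  rcases lt_or_gt_of_ne hne.1 with h | h
  · exact (hl v ⟨hv.1, h⟩).ne h0
  · rcases lt_or_gt_of_ne hne.2 with h' | h'
    · exact (hm v ⟨h, h'⟩).ne' h0
    · exact (hr v ⟨h', hv.2⟩).ne h0

theorem integrableOn_inv_sqrt_abs (H : IsHump Q p₁ p₂ p₃ p₄ m) :
    IntegrableOn (fun v => 1 / √|Q v|) (Icc p₁ p₄) := by
  have hc := H.contDiff.continuous
  obtain ⟨z₁, hz₁, h₁⟩ := H.exists_left_zero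
  obtain ⟨z₂, hz₂, h₂⟩ := H.exists_right_zero
  have hl : IntegrableOn (fun v => 1 / √|Q v|) (Icc p₁ p₂) := by
    refine integrableOn_inv_sqrt_of_linear_bound (z := z₁) hc H.slope_pos fun v hv => ?_
    rcases le_total v z₁ with h | h
    · have := H.increment_left hv.1 h hz₁.2.le
      rw [abs_of_nonpos (sub_nonpos.2 h)]
      have := neg_abs_le (Q v)
      linarith
    · have := H.increment_left hz₁.1.le h hv.2
      rw [abs_of_nonneg (sub_nonneg.2 h)]
      have := le_abs_self (Q v)
      linarith
  have hr : IntegrableOn (fun v => 1 / √|Q v|) (Icc p₃ p₄) := by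
    refine integrableOn_inv_sqrt_of_linear_bound (z := z₂) hc H.slope_pos fun v hv => ?_
    rcases le_total v z₂ with h | h
    · have := H.increment_right hv.1 h hz₂.2.le
      rw [abs_of_nonpos (sub_nonpos.2 h)]
      have := le_abs_self (Q v)
      linarith
    · have := H.increment_right hz₂.1.le h hv.2
      rw [abs_of_nonneg (sub_nonneg.2 h)]
      have := neg_abs_le (Q v)
      linarith
  have hmid : IntegrableOn (fun v => 1 / √|Q v|) (Icc p₂ p₃) := by
    refine ContinuousOn.integrableOn_Icc (continuousOn_const.div hc.abs.sqrt.continuousOn ?_)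
    intro v hv
    exact (Real.sqrt_pos.2 (abs_pos.2 (H.mid v hv).ne')).ne'
  rw [← Icc_union_Icc_eq_Icc (H.lt₁₂.le.trans H.le₂₃) H.lt₃₄.le,
    ← Icc_union_Icc_eq_Icc H.lt₁₂.le H.le₂₃]
  exact (hl.union hmid).union hr

theorem intervalIntegrable_div_sqrt (H : IsHump Q p₁ p₂ p₃ p₄ m) {G : ℝ → ℝ}
    (hG : Continuous G) : IntervalIntegrable (fun v => G v / √(2 * Q v)) volume p₁ p₄ := by
  rw [intervalIntegrable_iff_integrableOn_Icc_of_le H.lt₁₄.le]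
  have h1 : IntegrableOn (fun v => G v * (1 / √|Q v|)) (Icc p₁ p₄) :=
    H.integrableOn_inv_sqrt_abs.continuousOn_mul hG.continuousOn isCompact_Icc
  refine Integrable.mono h1 (hG.measurable.div
    ((H.contDiff.continuous.measurable.const_mul 2).sqrt)).aestronglyMeasurable ?_
  refine Eventually.of_forall fun v => ?_
  rw [div_eq_mul_one_div, norm_mul, norm_mul]
  gcongr ‖G v‖ * ?_
  rw [Real.norm_of_nonneg (by positivity), Real.norm_of_nonneg (by positivity)]
  rcases le_or_gt (Q v) 0 with h | h
  · rw [Real.sqrt_eq_zero_of_nonpos (by linarith)]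
    simp
  · rw [abs_of_pos h]
    refine one_div_le_one_div_of_le (Real.sqrt_pos.2 h) (Real.sqrt_le_sqrt (by linarith))

/-- Outside of the turning points `√(2Q)` vanishes, and with it the integrand (division by zero
being zero), so the moving domain of integration may be replaced by the fixed one. -/
theorem setIntegral_connectedComponentIn (H : IsHump Q p₁ p₂ p₃ p₄ m) {v₀ : ℝ}
    (hv₀ : v₀ ∈ Icc p₂ p₃) (G : ℝ → ℝ) :
    ∫ v in connectedComponentIn {v | 0 < Q v} v₀, G v / √(2 * Q v) =
      ∫ v in p₁..p₄, G v / √(2 * Q v) := by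
  obtain ⟨z₁, hz₁, z₂, hz₂, h₁, h₂, hl, hpos, hr⟩ := H.exists_turning_points
  rw [connectedComponentIn_pos_eq_Ioo h₁ h₂ hpos
      ⟨hz₁.2.trans_le hv₀.1, hv₀.2.trans_lt hz₂.1⟩, intervalIntegral.integral_of_le H.lt₁₄.le]
  symm
  refine setIntegral_eq_of_subset_of_forall_sdiff_eq_zero measurableSet_Ioc ?_ ?_
  · exact fun v hv => ⟨hz₁.1.trans hv.1, hv.2.le.trans hz₂.2.le⟩
  · rintro v ⟨hv, hn⟩
    have : Q v ≤ 0 := by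
      by_contra hq
      push Not at hq
      refine hn ⟨?_, ?_⟩
      · by_contra h
        rcases (not_lt.1 h).eq_or_lt with h | h
        · rw [h, h₁] at hq
          exact lt_irrefl _ hq
        · exact (hl v ⟨hv.1.le, h⟩).not_gt hq
      · by_contra h
        rcases (not_lt.1 h).eq_or_lt with h | h
        · rw [← h, h₂] at hq
          exact lt_irrefl _ hq
        · exact (hr v ⟨h, hv.2⟩).not_gt hq
    rw [Real.sqrt_eq_zero_of_nonpos (by linarith), div_zero]

/-- The integral of the derivative of `g √(2Q)`, which vanishes at both ends. -/
theorem integral_mul_deriv_div_sqrt (H : IsHump Q p₁ p₂ p₃ p₄ m) {g : ℝ → ℝ}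
    (hg : ContDiff ℝ 1 g) :
    ∫ v in p₁..p₄, g v * deriv Q v / √(2 * Q v) =
      -∫ v in p₁..p₄, √(2 * Q v) * deriv g v := by
  have hQc := H.contDiff.continuous
  have hQ'c := H.contDiff.continuous_deriv le_rfl
  have hg'c := hg.continuous_deriv le_rfl
  have hi₁ : IntervalIntegrable (fun v => g v * deriv Q v / √(2 * Q v)) volume p₁ p₄ :=
    H.intervalIntegrable_div_sqrt (hg.continuous.mul hQ'c)
  have hi₂ : IntervalIntegrable (fun v => √(2 * Q v) * deriv g v) volume p₁ p₄ :=
    (((continuous_const.mul hQc).sqrt).mul hg'c).intervalIntegrable _ _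
  rw [eq_neg_iff_add_eq_zero, ← intervalIntegral.integral_add hi₁ hi₂]
  rw [MeasureTheory.integral_eq_of_hasDerivAt_off_countable_of_le (fun v => √(2 * Q v) * g v) _
    H.lt₁₄.le H.countable_zeros ((continuous_const.mul hQc).sqrt.mul hg.continuous).continuousOn
    ?_ (hi₁.add hi₂)]
  · rw [Real.sqrt_eq_zero_of_nonpos (by linarith [H.neg₄]),
      Real.sqrt_eq_zero_of_nonpos (by linarith [H.neg₁])]
    simp
  · rintro v ⟨hv, hne⟩
    have hne' : 2 * Q v ≠ 0 := fun h => hne ⟨Ioo_subset_Icc_self hv, by linarith⟩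
    have h1 := (((H.contDiff.differentiable one_ne_zero v).hasDerivAt.const_mul 2).sqrt hne').mul
      (hg.differentiable one_ne_zero v).hasDerivAt
    refine h1.congr_deriv ?_
    rw [mul_div_mul_left _ _ (two_ne_zero' ℝ)]
    ring

end IsHump

theorem abs_sqrt_add_sub_sqrt_le {x : ℝ} (hx : x ≠ 0) (y : ℝ) :
    |√(x + y) - √x| ≤ |y| / √|x| := by
  have hs : 0 < √|x| := Real.sqrt_pos.2 (abs_pos.2 hx)
  rw [le_div_iff₀ hs]
  rcases lt_or_gt_of_ne hx with h | h
  · rw [Real.sqrt_eq_zero_of_nonpos h.le, sub_zero, abs_of_nonneg (Real.sqrt_nonneg _),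
      abs_of_neg h]
    rcases le_or_gt (x + y) 0 with h' | h'
    · rw [Real.sqrt_eq_zero_of_nonpos h', zero_mul]
      positivity
    · have h1 := Real.sq_sqrt h'.le
      have h2 := Real.sq_sqrt (neg_pos.2 h).le
      have := le_abs_self y
      nlinarith [sq_nonneg (√(x + y) - √(-x))]
  · rw [abs_of_pos h]
    have h2 := Real.sq_sqrt h.le
    rcases le_or_gt (x + y) 0 with h' | h'
    · rw [Real.sqrt_eq_zero_of_nonpos h', zero_sub, abs_neg, abs_of_nonneg (Real.sqrt_nonneg _)]
      have := neg_abs_le y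
      nlinarith
    · have h1 := Real.sq_sqrt h'.le
      have h3 : y = (√(x + y) - √x) * (√(x + y) + √x) := by nlinarith
      conv_rhs => rw [h3, abs_mul]
      gcongr
      rw [abs_of_nonneg (by positivity)]
      have := Real.sqrt_nonneg (x + y)
      linarith

theorem hasDerivAt_mul_of_continuousAt_zero {B : ℝ → ℝ} (hB : ContinuousAt B 0) :
    HasDerivAt (fun e => e * B e) (B 0) 0 := by
  rw [hasDerivAt_iff_tendsto_slope_zero]
  refine (hB.tendsto.mono_left nhdsWithin_le_nhds).congr' ?_
  filter_upwards [self_mem_nhdsWithin] with e he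
  have : e ≠ 0 := he
  simp [this]

namespace IsHump

variable {R : ℝ → ℝ} {p₁ p₂ p₃ p₄ m : ℝ}

theorem hasDerivAt_integral_sqrt (H : IsHump R p₁ p₂ p₃ p₄ m) {p G : ℝ → ℝ}
    (hp : Continuous p) (hG : Continuous G) :
    HasDerivAt (fun e => ∫ v in p₁..p₄, √(2 * (R v + e * p v)) * G v)
      (∫ v in p₁..p₄, p v * G v / √(2 * R v)) 0 := by
  have hRc := H.contDiff.continuous
  have hint : ∀ e, IntervalIntegrable (fun v => √(2 * (R v + e * p v)) * G v) volume p₁ p₄ :=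
    fun e => Continuous.intervalIntegrable (by fun_prop) _ _
  rw [hasDerivAt_iff_tendsto_slope_zero]
  simp_rw [zero_add, ← intervalIntegral.integral_sub (hint _) (hint _), smul_eq_mul,
    ← intervalIntegral.integral_const_mul, intervalIntegral.integral_of_le H.lt₁₄.le]
  have hne : ∀ᵐ v ∂(volume.restrict (Ioc p₁ p₄)), R v ≠ 0 := by
    rw [ae_restrict_iff' measurableSet_Ioc]
    have := H.countable_zeros.ae_notMem volume
    filter_upwards [this] with v hv hv' h0
    exact hv ⟨Ioc_subset_Icc_self hv', h0⟩
  refine tendsto_integral_filter_of_dominated_convergence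
    (fun v => (2 * |p v| * |G v|) * (1 / √|R v|)) ?_ ?_ ?_ ?_
  · refine Eventually.of_forall fun e => Continuous.aestronglyMeasurable (by fun_prop)
  · filter_upwards [self_mem_nhdsWithin] with e he
    have he : e ≠ 0 := he
    filter_upwards [hne] with v hv
    have h1 := abs_sqrt_add_sub_sqrt_le (mul_ne_zero two_ne_zero hv) (2 * (e * p v))
    rw [← mul_add] at h1
    have h2 : √|R v| ≤ √|2 * R v| := by
      refine Real.sqrt_le_sqrt ?_
      rw [abs_mul, abs_two]
      linarith [abs_nonneg (R v)]
    have h3 : 0 < √|R v| := Real.sqrt_pos.2 (abs_pos.2 hv)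
    rw [zero_mul, add_zero, ← sub_mul, norm_mul, norm_mul, norm_inv, Real.norm_eq_abs,
      Real.norm_eq_abs, Real.norm_eq_abs]
    have h4 : |√(2 * (R v + e * p v)) - √(2 * R v)| ≤ |e| * (2 * |p v|) / √|R v| := by
      refine h1.trans ?_
      rw [show |2 * (e * p v)| = |e| * (2 * |p v|) by rw [abs_mul, abs_mul, abs_two]; ring]
      gcongr
    calc |e|⁻¹ * (|√(2 * (R v + e * p v)) - √(2 * R v)| * |G v|)
        ≤ |e|⁻¹ * (|e| * (2 * |p v|) / √|R v| * |G v|) := by gcongr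
      _ = _ := by
        have : |e| ≠ 0 := abs_ne_zero.2 he
        field_simp
  · exact (H.integrableOn_inv_sqrt_abs.continuousOn_mul
      (g := fun v => 2 * |p v| * |G v|) (by fun_prop) isCompact_Icc).mono_set Ioc_subset_Icc_self
  · filter_upwards [hne] with v hv
    have h1 : HasDerivAt (fun e => √(2 * (R v + e * p v)) * G v) (p v * G v / √(2 * R v)) 0 := by
      have h2 : HasDerivAt (fun e => 2 * (R v + e * p v)) (2 * p v) 0 := by
        simpa using (((hasDerivAt_id (0 : ℝ)).mul_const (p v)).const_add (R v)).const_mul 2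
      refine ((h2.sqrt (by simpa using hv)).mul_const (G v)).congr_deriv ?_
      rw [zero_mul, add_zero, mul_div_mul_left _ _ (two_ne_zero' ℝ)]
      ring
    rw [hasDerivAt_iff_tendsto_slope_zero] at h1
    simpa using h1

/-- The condition `IsHump` is stable under small `C¹` perturbations. -/
theorem perturb (H : IsHump R p₁ p₂ p₃ p₄ m) {p : ℝ → ℝ} (hp : ContDiff ℝ 1 p) :
    ∀ᶠ e in 𝓝 (0 : ℝ), IsHump (fun v => R v + e * p v) p₁ p₂ p₃ p₄ (m / 2) := by
  have hRc := H.contDiff.continuous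
  have hm := H.slope_pos
  obtain ⟨C, hC⟩ := (isCompact_Icc (a := p₁) (b := p₄)).exists_bound_of_continuousOn
    hp.continuous.continuousOn
  obtain ⟨C', hC'⟩ := (isCompact_Icc (a := p₁) (b := p₄)).exists_bound_of_continuousOn
    (hp.continuous_deriv le_rfl).continuousOn
  obtain ⟨w, hw, hmin⟩ := (isCompact_Icc (a := p₂) (b := p₃)).exists_isMinOn
    (nonempty_Icc.2 H.le₂₃) hRc.continuousOn
  have hsmall : ∀ B b : ℝ, 0 < b → ∀ᶠ e in 𝓝 (0 : ℝ), |e| * B < b := by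
    intro B b hb
    have : Tendsto (fun e : ℝ => |e| * B) (𝓝 0) (𝓝 (|0| * B)) :=
      (continuous_abs.mul continuous_const).tendsto 0
    rw [abs_zero, zero_mul] at this
    exact this.eventually_lt_const hb
  have key : ∀ (e B x : ℝ), ‖x‖ ≤ B → |e * x| ≤ |e| * B := fun e B x h => by
    rw [abs_mul]; exact mul_le_mul_of_nonneg_left h (abs_nonneg e)
  filter_upwards [hsmall C (R w) (H.mid w hw), hsmall C (-R p₁) (by linarith [H.neg₁]),
    hsmall C (-R p₄) (by linarith [H.neg₄]), hsmall C' (m / 2) (by linarith)] with e h1 h2 h3 h4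
  have hd : ∀ v, deriv (fun v => R v + e * p v) v = deriv R v + e * deriv p v := fun v =>
    ((H.contDiff.differentiable one_ne_zero v).hasDerivAt.add
      ((hp.differentiable one_ne_zero v).hasDerivAt.const_mul e)).deriv
  have h14 := H.lt₁₄
  have h12 := H.lt₁₂
  have h23 := H.le₂₃
  have h34 := H.lt₃₄
  refine ⟨H.contDiff.add (contDiff_const.mul hp), by linarith, h12, h23, h34, ?_, ?_, ?_, ?_, ?_⟩
  · intro v hv
    have := (abs_le.1 (key e C' _ (hC' v ⟨hv.1, by linarith [hv.2]⟩))).1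
    rw [hd]
    linarith [H.left v hv]
  · intro v hv
    have := (abs_le.1 (key e C' _ (hC' v ⟨by linarith [hv.1], hv.2⟩))).2
    rw [hd]
    linarith [H.right v hv]
  · intro v hv
    have := (abs_le.1 (key e C _ (hC v ⟨by linarith [hv.1], by linarith [hv.2]⟩))).1
    have := isMinOn_iff.1 hmin v hv
    linarith
  · have := (abs_le.1 (key e C _ (hC p₁ ⟨le_rfl, h14.le⟩))).2
    show R p₁ + e * p p₁ < 0
    linarith
  · have := (abs_le.1 (key e C _ (hC p₄ ⟨h14.le, le_rfl⟩))).2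
    show R p₄ + e * p p₄ < 0
    linarith

/-- The integral of `h / √(2(R + e p))`, rewritten by means of the Bezout relation
`α R' + β R = 1` and one integration by parts, so that its leading part has no singularity at the
turning points. -/
theorem integral_div_sqrt_eq {p α β h : ℝ → ℝ} {e : ℝ} (hR : ContDiff ℝ 1 R)
    (He : IsHump (fun v => R v + e * p v) p₁ p₂ p₃ p₄ m)
    (hp : ContDiff ℝ 1 p) (hα : ContDiff ℝ 1 α) (hβ : ContDiff ℝ 1 β)
    (hbez : ∀ v ∈ Icc p₁ p₄, α v * deriv R v + β v * R v = 1) (hh : ContDiff ℝ 1 h) :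
    ∫ v in p₁..p₄, h v / √(2 * (R v + e * p v)) =
      (∫ v in p₁..p₄, √(2 * (R v + e * p v)) *
        (h v * β v / 2 - deriv (fun v => h v * α v) v)) -
      e * ∫ v in p₁..p₄, h v * (α v * deriv p v + β v * p v) / √(2 * (R v + e * p v)) := by
  have hd : ∀ v, deriv (fun v => R v + e * p v) v = deriv R v + e * deriv p v := fun v =>
    ((hR.differentiable one_ne_zero v).hasDerivAt.add
      ((hp.differentiable one_ne_zero v).hasDerivAt.const_mul e)).deriv
  have hRc := hR.continuous
  have hpc := hp.continuous
  have hp'c := hp.continuous_deriv le_rfl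
  have hαc := hα.continuous
  have hβc := hβ.continuous
  have hhc := hh.continuous
  have hhα : ContDiff ℝ 1 (fun v => h v * α v) := hh.mul hα
  have hhα' := hhα.continuous_deriv le_rfl
  have hibp := He.integral_mul_deriv_div_sqrt hhα
  have hi₁ : IntervalIntegrable (fun v => h v * α v * deriv (fun v => R v + e * p v) v /
      √(2 * (R v + e * p v))) volume p₁ p₄ := by
    refine He.intervalIntegrable_div_sqrt (G := fun v => h v * α v *
      deriv (fun v => R v + e * p v) v) ?_
    exact hhα.continuous.mul (He.contDiff.continuous_deriv le_rfl)
  have hi₂ : IntervalIntegrable (fun v => √(2 * (R v + e * p v)) * (h v * β v / 2))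
      volume p₁ p₄ := Continuous.intervalIntegrable (by fun_prop) _ _
  have hi₃ : IntervalIntegrable (fun v => √(2 * (R v + e * p v)) *
      deriv (fun v => h v * α v) v) volume p₁ p₄ :=
    Continuous.intervalIntegrable (by fun_prop) _ _
  have hi₄ : IntervalIntegrable (fun v => h v * (α v * deriv p v + β v * p v) /
      √(2 * (R v + e * p v))) volume p₁ p₄ :=
    He.intervalIntegrable_div_sqrt (G := fun v => h v * (α v * deriv p v + β v * p v))
      (by fun_prop)
  have hpt : EqOn (fun v => h v / √(2 * (R v + e * p v)))
      (fun v => h v * α v * deriv (fun v => R v + e * p v) v / √(2 * (R v + e * p v)) +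
        √(2 * (R v + e * p v)) * (h v * β v / 2) -
        e * (h v * (α v * deriv p v + β v * p v) / √(2 * (R v + e * p v)))) (uIcc p₁ p₄) := by
    intro v hv
    rw [uIcc_of_le He.lt₁₄.le] at hv
    have hb := hbez v hv
    simp only [hd]
    rcases le_or_gt (R v + e * p v) 0 with hq | hq
    · rw [Real.sqrt_eq_zero_of_nonpos (by linarith)]
      simp
    · have hs : 0 < √(2 * (R v + e * p v)) := Real.sqrt_pos.2 (by linarith)
      have hs2 := Real.sq_sqrt (show 0 ≤ 2 * (R v + e * p v) by linarith)
      field_simp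
      rw [hs2]
      linear_combination (-2 * h v) * hb
  rw [intervalIntegral.integral_congr hpt, intervalIntegral.integral_sub (hi₁.add hi₂)
    (hi₄.const_mul e), intervalIntegral.integral_add hi₁ hi₂, hibp,
    intervalIntegral.integral_const_mul]
  simp_rw [mul_sub]
  rw [intervalIntegral.integral_sub hi₂ hi₃]
  ring

theorem continuousAt_integral_div_sqrt (H : IsHump R p₁ p₂ p₃ p₄ m) {p α β h : ℝ → ℝ}
    (hp : ContDiff ℝ 1 p) (hα : ContDiff ℝ 1 α) (hβ : ContDiff ℝ 1 β)
    (hbez : ∀ v ∈ Icc p₁ p₄, α v * deriv R v + β v * R v = 1) (hh : ContDiff ℝ 1 h) :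
    ContinuousAt (fun e => ∫ v in p₁..p₄, h v / √(2 * (R v + e * p v))) 0 := by
  have h14 := H.lt₁₄.le
  have hcont : ∀ g : ℝ → ℝ, Continuous g → ∃ C, 0 ≤ C ∧ ∀ v ∈ Icc p₁ p₄, |g v| ≤ C := by
    intro g hg
    obtain ⟨C, hC⟩ := (isCompact_Icc (a := p₁) (b := p₄)).exists_bound_of_continuousOn
      hg.continuousOn
    exact ⟨C, (norm_nonneg _).trans (hC p₁ ⟨le_rfl, h14⟩), hC⟩
  have hpc := hp.continuous
  have hp'c := hp.continuous_deriv le_rfl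
  have hαc := hα.continuous
  have hβc := hβ.continuous
  have hhc := hh.continuous
  have hhα : ContDiff ℝ 1 (fun v => h v * α v) := hh.mul hα
  have hhα'c := hhα.continuous_deriv le_rfl
  -- An integral against `1 / √(2Q)` is at most the supremum of the density times the case `h = 1`.
  have hdom : ∀ (Q g : ℝ → ℝ) (m' C : ℝ), IsHump Q p₁ p₂ p₃ p₄ m' → Continuous g →
      (∀ v ∈ Icc p₁ p₄, |g v| ≤ C) →
      |∫ v in p₁..p₄, g v / √(2 * Q v)| ≤ C * ∫ v in p₁..p₄, 1 / √(2 * Q v) := by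
    intro Q g m' C HQ hg hC
    rw [← intervalIntegral.integral_const_mul]
    rw [← Real.norm_eq_abs]
    refine intervalIntegral.norm_integral_le_of_norm_le h14 (Eventually.of_forall fun v hv => ?_)
      ((HQ.intervalIntegrable_div_sqrt continuous_const).const_mul C)
    rw [norm_div, Real.norm_of_nonneg (Real.sqrt_nonneg _), mul_one_div]
    exact div_le_div_of_nonneg_right (hC v (Ioc_subset_Icc_self hv)) (Real.sqrt_nonneg _)
  obtain ⟨C₁, hC₁, hb₁⟩ := hcont (fun v => 1 * (α v * deriv p v + β v * p v)) (by fun_prop)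
  obtain ⟨C₂, hC₂, hb₂⟩ := hcont (fun v => h v * (α v * deriv p v + β v * p v)) (by fun_prop)
  have h1α : ContDiff ℝ 1 (fun v => (1 : ℝ) * α v) := contDiff_const.mul hα
  have h1α' := h1α.continuous_deriv le_rfl
  have hA₁ := (H.hasDerivAt_integral_sqrt (p := p)
    (G := fun v => (1 : ℝ) * β v / 2 - deriv (fun v => (1 : ℝ) * α v) v) hpc
    (by fun_prop)).continuousAt
  have hA₂ := (H.hasDerivAt_integral_sqrt (p := p)
    (G := fun v => h v * β v / 2 - deriv (fun v => h v * α v) v) hpc (by fun_prop)).continuousAt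
  set A₁ : ℝ → ℝ := fun e => ∫ v in p₁..p₄, √(2 * (R v + e * p v)) *
    ((1 : ℝ) * β v / 2 - deriv (fun v => (1 : ℝ) * α v) v)
  set A₂ : ℝ → ℝ := fun e => ∫ v in p₁..p₄, √(2 * (R v + e * p v)) *
    (h v * β v / 2 - deriv (fun v => h v * α v) v)
  set S : ℝ → ℝ := fun e => ∫ v in p₁..p₄, 1 / √(2 * (R v + e * p v))
  have hbdd : ∀ᶠ e in 𝓝 (0 : ℝ), S e ≤ 2 * (A₁ 0 + 1) := by
    have hsm : ∀ᶠ e in 𝓝 (0 : ℝ), |e| * C₁ < 1 / 2 := by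
      have : Tendsto (fun e : ℝ => |e| * C₁) (𝓝 0) (𝓝 (|0| * C₁)) :=
        (continuous_abs.mul continuous_const).tendsto 0
      rw [abs_zero, zero_mul] at this
      exact this.eventually_lt_const (by norm_num)
    filter_upwards [H.perturb hp, hA₁.tendsto.eventually_lt_const (lt_add_one (A₁ 0)), hsm]
      with e He hlt hs
    have hid := integral_div_sqrt_eq (h := fun _ => 1) H.contDiff He hp hα hβ hbez contDiff_const
    have hd := hdom _ _ _ C₁ He (by fun_prop) hb₁
    have hS0 : 0 ≤ S e := intervalIntegral.integral_nonneg h14 fun v _ => by positivity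
    change S e = A₁ e - e * _ at hid
    change _ ≤ C₁ * S e at hd
    have h3 := mul_le_mul_of_nonneg_left hd (abs_nonneg e)
    rw [← abs_mul] at h3
    have h4 := (abs_le.1 h3).1
    have h5 : |e| * C₁ * S e ≤ 1 / 2 * S e := mul_le_mul_of_nonneg_right hs.le hS0
    have h6 : |e| * (C₁ * S e) = |e| * C₁ * S e := by ring
    linarith
  have hrem : Tendsto (fun e => e * ∫ v in p₁..p₄,
      h v * (α v * deriv p v + β v * p v) / √(2 * (R v + e * p v))) (𝓝 0) (𝓝 0) := by
    have hlim : Tendsto (fun e : ℝ => |e| * (C₂ * (2 * (A₁ 0 + 1)))) (𝓝 0) (𝓝 0) := by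
      have : Tendsto (fun e : ℝ => |e| * (C₂ * (2 * (A₁ 0 + 1)))) (𝓝 0)
          (𝓝 (|0| * (C₂ * (2 * (A₁ 0 + 1))))) :=
        (continuous_abs.mul continuous_const).tendsto 0
      rwa [abs_zero, zero_mul] at this
    refine squeeze_zero_norm' ?_ hlim
    filter_upwards [H.perturb hp, hbdd] with e He hS'
    rw [norm_mul, Real.norm_eq_abs, Real.norm_eq_abs]
    refine mul_le_mul_of_nonneg_left ?_ (abs_nonneg e)
    exact (hdom _ _ _ C₂ He (by fun_prop) hb₂).trans (mul_le_mul_of_nonneg_left hS' hC₂)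
  have hfin := hA₂.tendsto.sub hrem
  have h0 := integral_div_sqrt_eq (e := 0) H.contDiff (by simpa using H) hp hα hβ hbez hh
  rw [zero_mul] at h0
  rw [ContinuousAt, h0]
  refine hfin.congr' ?_
  filter_upwards [H.perturb hp] with e He
  exact (integral_div_sqrt_eq H.contDiff He hp hα hβ hbez hh).symm

/-- Differentiation of the loop integral `∫ h / √(2R)` in the direction `p`. Formally the
derivative is the divergent integral `-∫ p h (2R) ^ (-3/2)`; the right-hand side is its finite part,
expressed by means of a Bezout relation `α R' + β R = 1`. -/
theorem hasDerivAt_loop_integral (H : IsHump R p₁ p₂ p₃ p₄ m) {p α β h : ℝ → ℝ} {v₀ : ℝ}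
    (hv₀ : v₀ ∈ Icc p₂ p₃)
    (hp : ContDiff ℝ 2 p) (hα : ContDiff ℝ 1 α) (hβ : ContDiff ℝ 1 β)
    (hbez : ∀ v ∈ Icc p₁ p₄, α v * deriv R v + β v * R v = 1) (hh : ContDiff ℝ 1 h) :
    HasDerivAt (fun e => ∫ v in connectedComponentIn {v | 0 < R v + e * p v} v₀,
        h v / √(2 * (R v + e * p v)))
      (-∫ v in connectedComponentIn {v | 0 < R v} v₀,
        (deriv (fun v => p v * h v * α v) v + p v * h v * β v / 2) / √(2 * R v)) 0 := by
  have hp1 : ContDiff ℝ 1 p := hp.of_le one_le_two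
  have hp' : ContDiff ℝ 1 (deriv p) := contDiff_one_deriv hp
  have hpc := hp.continuous
  have hp'c := hp'.continuous
  have hαc := hα.continuous
  have hβc := hβ.continuous
  have hhc := hh.continuous
  have hhα : ContDiff ℝ 1 (fun v => h v * α v) := hh.mul hα
  have hhα'c := hhα.continuous_deriv le_rfl
  have hA := H.hasDerivAt_integral_sqrt (p := p)
    (G := fun v => h v * β v / 2 - deriv (fun v => h v * α v) v) hpc (by fun_prop)
  have hB := hasDerivAt_mul_of_continuousAt_zero (H.continuousAt_integral_div_sqrt
    (h := fun v => h v * (α v * deriv p v + β v * p v)) hp1 hα hβ hbez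
    (hh.mul ((hα.mul hp').add (hβ.mul hp1))))
  have hAB := hA.sub hB
  have hval : (∫ v in p₁..p₄, p v * (h v * β v / 2 - deriv (fun v => h v * α v) v) /
        √(2 * R v)) -
      ∫ v in p₁..p₄, h v * (α v * deriv p v + β v * p v) / √(2 * (R v + 0 * p v)) =
      -∫ v in connectedComponentIn {v | 0 < R v} v₀,
        (deriv (fun v => p v * h v * α v) v + p v * h v * β v / 2) / √(2 * R v) := by
    simp_rw [zero_mul, add_zero]
    rw [H.setIntegral_connectedComponentIn hv₀ (fun v => deriv (fun v => p v * h v * α v) v +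
      p v * h v * β v / 2), ← intervalIntegral.integral_sub
      (H.intervalIntegrable_div_sqrt (G := fun v => p v * (h v * β v / 2 -
        deriv (fun v => h v * α v) v)) (by fun_prop))
      (H.intervalIntegrable_div_sqrt (G := fun v => h v * (α v * deriv p v + β v * p v))
        (by fun_prop)), ← intervalIntegral.integral_neg]
    refine intervalIntegral.integral_congr fun v _ => ?_
    have hd : deriv (fun v => p v * h v * α v) v =
        deriv p v * (h v * α v) + p v * deriv (fun v => h v * α v) v := by
      have := ((hp1.differentiable one_ne_zero v).hasDerivAt.mul
        (hhα.differentiable one_ne_zero v).hasDerivAt).deriv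
      rw [← this]
      congr 1
      funext w
      simp only [Pi.mul_apply]
      ring
    simp only [hd]
    ring
  rw [hval] at hAB
  refine hAB.congr_of_eventuallyEq ?_
  filter_upwards [H.perturb hp1] with e He
  rw [He.setIntegral_connectedComponentIn hv₀ h]
  exact integral_div_sqrt_eq H.contDiff He hp1 hα hβ hbez hh

end IsHump

/-! ### The phase portrait -/

/-- Uniqueness for `w'' = P(w)` among bounded solutions. -/
theorem eq_of_second_order_ode {P u w : ℝ → ℝ} {A B x₀ : ℝ} (hP : ContDiff ℝ 1 P)
    (hu : ContDiff ℝ 2 u) (hw : ContDiff ℝ 2 w)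
    (hu' : ∀ x, deriv (deriv u) x = P (u x)) (hw' : ∀ x, deriv (deriv w) x = P (w x))
    (huAB : ∀ x, u x ∈ Icc A B) (hwAB : ∀ x, w x ∈ Icc A B)
    (h0 : u x₀ = w x₀) (h1 : deriv u x₀ = deriv w x₀) : u = w := by
  obtain ⟨K, hK⟩ := hP.contDiffOn.exists_lipschitzOnWith one_ne_zero (convex_Icc A B) isCompact_Icc
  have hsol : ∀ z : ℝ → ℝ, ContDiff ℝ 2 z → (∀ x, deriv (deriv z) x = P (z x)) →
      (∀ x, z x ∈ Icc A B) → ∀ t, HasDerivAt (fun t => (z t, deriv z t))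
        ((fun y : ℝ × ℝ => (y.2, P y.1)) (z t, deriv z t)) t ∧
        (z t, deriv z t) ∈ Icc A B ×ˢ (univ : Set ℝ) := by
    intro z hz hz' hzAB t
    have hz1 : ContDiff ℝ 1 (deriv z) := contDiff_one_deriv hz
    refine ⟨?_, hzAB t, mem_univ _⟩
    have h2 := (hz1.differentiable one_ne_zero t).hasDerivAt
    rw [hz'] at h2
    exact (hz.differentiable two_ne_zero t).hasDerivAt.prodMk h2
  have hlip : LipschitzOnWith (max 1 (K * 1)) (fun y : ℝ × ℝ => (y.2, P y.1))
      (Icc A B ×ˢ (univ : Set ℝ)) := by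
    refine LipschitzOnWith.prodMk LipschitzWith.prod_snd.lipschitzOnWith ?_
    exact hK.comp LipschitzWith.prod_fst.lipschitzOnWith fun y hy => hy.1
  have := ODE_solution_unique_univ (v := fun _ y => (y.2, P y.1)) (t₀ := x₀) (fun _ => hlip)
    (hsol u hu hu' huAB) (hsol w hw hw' hwAB) (by rw [h0, h1])
  funext t
  exact congrArg Prod.fst (congrFun this t)

/-- A half oscillation of the wave: `u` increases from its minimum at `x₀` to its maximum at `x₁`,
and is symmetric about both points. -/
structure IsHalfWave (R u : ℝ → ℝ) (x₀ x₁ : ℝ) : Prop where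
  lt : x₀ < x₁
  deriv_pos : ∀ x ∈ Ioo x₀ x₁, 0 < deriv u x
  reflect_left : ∀ x, u (2 * x₀ - x) = u x
  periodic : Function.Periodic u (2 * (x₁ - x₀))
  gap_left : R (u x₀) = 0
  gap_right : R (u x₁) = 0
  slope_left : 0 < deriv R (u x₀)
  slope_right : deriv R (u x₁) < 0

/-- A non-constant periodic solution of `u'' = R'(u)`, `u'² = 2 R(u)` contains a half
oscillation. -/
theorem exists_isHalfWave {R u : ℝ → ℝ} (hR : ContDiff ℝ 2 R) (hu : ContDiff ℝ 2 u)
    (henergy : ∀ x, deriv u x ^ 2 / 2 = R (u x)) (hprofile : ∀ x, deriv (deriv u) x = deriv R (u x))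
    (hper : ∃ p, 0 < p ∧ Function.Periodic u p) (hnc : ∃ x y, u x ≠ u y) :
    ∃ x₀ x₁, IsHalfWave R u x₀ x₁ := by
  obtain ⟨p, hp, hper⟩ := hper
  have hR1 : ContDiff ℝ 1 (deriv R) := contDiff_one_deriv hR
  have hu1 : ContDiff ℝ 1 (deriv u) := contDiff_one_deriv hu
  have huc := hu.continuous
  have hu'c := hu1.continuous
  -- The extrema of `u` over one period are global.
  obtain ⟨x₀, -, hmin'⟩ := (isCompact_Icc (a := 0) (b := p)).exists_isMinOn
    (nonempty_Icc.2 hp.le) huc.continuousOn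
  obtain ⟨xM, -, hmax'⟩ := (isCompact_Icc (a := 0) (b := p)).exists_isMaxOn
    (nonempty_Icc.2 hp.le) huc.continuousOn
  have hmin : ∀ x, u x₀ ≤ u x := by
    intro x
    obtain ⟨y, hy, hxy⟩ := hper.exists_mem_Ico₀ hp x
    rw [hxy]
    exact isMinOn_iff.1 hmin' y ⟨hy.1, hy.2.le⟩
  have hmax : ∀ x, u x ≤ u xM := by
    intro x
    obtain ⟨y, hy, hxy⟩ := hper.exists_mem_Ico₀ hp x
    rw [hxy]
    exact isMaxOn_iff.1 hmax' y ⟨hy.1, hy.2.le⟩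
  have huAB : ∀ x, u x ∈ Icc (u x₀) (u xM) := fun x => ⟨hmin x, hmax x⟩
  have hcrit₀ : deriv u x₀ = 0 :=
    IsLocalMin.deriv_eq_zero (Eventually.of_forall hmin)
  -- At a critical point the acceleration does not vanish: the wave would be an equilibrium.
  have hnondeg : ∀ x, deriv u x = 0 → deriv R (u x) ≠ 0 := by
    intro x hx h
    have : u = fun _ => u x := by
      refine eq_of_second_order_ode (x₀ := x) hR1 hu contDiff_const hprofile ?_ huAB
        (fun _ => huAB x) rfl ?_
      · intro y
        rw [h]
        simp
      · rw [hx]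
        simp
    obtain ⟨y, z, hyz⟩ := hnc
    exact hyz ((congrFun this y).trans (congrFun this z).symm)
  have hreflect : ∀ x, deriv u x = 0 → ∀ y, u (2 * x - y) = u y := by
    intro x hx
    have hrd : deriv (fun y => u (2 * x - y)) = fun y => -deriv u (2 * x - y) :=
      funext fun y => deriv_comp_const_sub u _ _
    have : (fun y => u (2 * x - y)) = u := by
      refine eq_of_second_order_ode (x₀ := x) hR1 (hu.comp (contDiff_const.sub contDiff_id)) hu
        ?_ hprofile (fun y => huAB _) huAB ?_ ?_
      · intro y
        rw [hrd, deriv.fun_neg, deriv_comp_const_sub, neg_neg, hprofile]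
      · simp [two_mul]
      · rw [hrd]
        simp [two_mul, hx]
    exact congrFun this
  have hd2 : ∀ x, HasDerivAt (deriv u) (deriv R (u x)) x := fun x => by
    have := (hu1.differentiable one_ne_zero x).hasDerivAt
    rwa [hprofile] at this
  have hgap : ∀ x, deriv u x = 0 → R (u x) = 0 := fun x hx => by
    rw [← henergy, hx]
    norm_num
  have hslope₀ : 0 < deriv R (u x₀) := by
    refine lt_of_le_of_ne ?_ (hnondeg x₀ hcrit₀).symm
    by_contra hneg
    push Not at hneg
    -- A negative acceleration at `x₀` would make `u` decrease to the right of the minimum.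
    have hev : ∀ᶠ x in 𝓝[>] x₀, deriv u x < 0 := by
      have := (hd2 x₀).hasDerivWithinAt (s := Ioi x₀)
      rw [hasDerivWithinAt_iff_tendsto_slope' (by simp)] at this
      filter_upwards [this.eventually_lt_const hneg, self_mem_nhdsWithin] with x hx hx0
      rw [slope_def_field, hcrit₀, sub_zero] at hx
      exact (div_neg_iff.1 hx).resolve_left (fun h => by
        have := h.2; simp only [mem_Ioi] at hx0; linarith) |>.1
    obtain ⟨b, hb, hsub⟩ := mem_nhdsGT_iff_exists_Ioo_subset.1 hev
    have hanti : StrictAntiOn u (Icc x₀ b) :=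
      strictAntiOn_of_deriv_neg (convex_Icc _ _) huc.continuousOn
        (fun x hx => by rw [interior_Icc] at hx; exact hsub hx)
    have hb' : x₀ < b := hb
    exact (hanti ⟨le_rfl, hb'.le⟩ ⟨hb'.le, le_rfl⟩ hb').not_ge (hmin b)
  obtain ⟨b, hb, hbpos⟩ : ∃ b, x₀ < b ∧ ∀ x ∈ Ioo x₀ b, 0 < deriv u x := by
    have hev : ∀ᶠ x in 𝓝[>] x₀, 0 < deriv u x := by
      have := (hd2 x₀).hasDerivWithinAt (s := Ioi x₀)
      rw [hasDerivWithinAt_iff_tendsto_slope' (by simp)] at this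
      filter_upwards [this.eventually_const_lt hslope₀, self_mem_nhdsWithin] with x hx hx0
      rw [slope_def_field, hcrit₀, sub_zero] at hx
      have h1 : 0 < x - x₀ := sub_pos.2 hx0
      exact (div_pos_iff_of_pos_right h1).1 hx
    obtain ⟨b, hb, hsub⟩ := mem_nhdsGT_iff_exists_Ioo_subset.1 hev
    exact ⟨b, hb, hsub⟩
  -- The next critical point.
  set Z : Set ℝ := {x | b ≤ x ∧ deriv u x = 0}
  have hZne : Z.Nonempty := by
    obtain ⟨n, hn⟩ := exists_nat_ge ((b - x₀) / p)
    rw [div_le_iff₀ hp] at hn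
    refine ⟨x₀ + n * p, by linarith, ?_⟩
    have h1 : deriv u (x₀ + n * p) = deriv u x₀ := by
      have := deriv_comp_add_const u (n * p) x₀
      rw [← this]
      congr 1
      funext y
      exact hper.nat_mul n y
    rw [h1, hcrit₀]
  have hZcl : IsClosed Z := isClosed_Ici.inter (isClosed_eq hu'c continuous_const)
  have hZbd : BddBelow Z := ⟨b, fun x hx => hx.1⟩
  set x₁ := sInf Z
  have hx₁Z : x₁ ∈ Z := hZcl.csInf_mem hZne hZbd
  have hlt : x₀ < x₁ := hb.trans_le hx₁Z.1
  have hpos : ∀ x ∈ Ioo x₀ x₁, 0 < deriv u x := by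
    intro x hx
    rcases lt_or_ge x b with h | h
    · exact hbpos x ⟨hx.1, h⟩
    by_contra hn
    push Not at hn
    -- A sign change of `u'` before `x₁` would produce an earlier critical point.
    have hmid : (x₀ + b) / 2 ∈ Ioo x₀ b := ⟨by linarith, by linarith⟩
    obtain ⟨y, hy, hy0⟩ := intermediate_value_Icc' (show (x₀ + b) / 2 ≤ x by linarith [hmid.2])
      hu'c.continuousOn ⟨hn, (hbpos _ hmid).le⟩
    have hyb : b ≤ y := by
      by_contra hyb
      push Not at hyb
      exact (hbpos y ⟨hmid.1.trans_le hy.1, hyb⟩).ne' hy0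
    exact (csInf_le hZbd ⟨hyb, hy0⟩).not_gt (hy.2.trans_lt hx.2)
  have hslope₁ : deriv R (u x₁) < 0 := by
    refine lt_of_le_of_ne ?_ (hnondeg x₁ hx₁Z.2)
    by_contra hneg
    push Not at hneg
    have hev : ∀ᶠ x in 𝓝[<] x₁, deriv u x < 0 := by
      have := (hd2 x₁).hasDerivWithinAt (s := Iio x₁)
      rw [hasDerivWithinAt_iff_tendsto_slope' (by simp)] at this
      filter_upwards [this.eventually_const_lt hneg, self_mem_nhdsWithin] with x hx hx0
      rw [slope_def_field, hx₁Z.2, sub_zero] at hx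
      have h1 : x - x₁ < 0 := sub_neg.2 hx0
      exact (div_pos_iff.1 hx).resolve_left (fun h => by linarith [h.2]) |>.1
    have hev2 : ∀ᶠ x in 𝓝[<] x₁, x ∈ Ioo x₀ x₁ := Ioo_mem_nhdsLT hlt
    obtain ⟨x, hx1, hx2⟩ := (hev.and hev2).exists
    exact (hpos x hx2).not_gt hx1
  refine ⟨x₀, x₁, hlt, hpos, hreflect x₀ hcrit₀, ?_, hgap x₀ hcrit₀, hgap x₁ hx₁Z.2, hslope₀,
    hslope₁⟩
  intro x
  rw [← hreflect x₁ hx₁Z.2 (x + 2 * (x₁ - x₀)), ← hreflect x₀ hcrit₀ x]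
  congr 1
  ring

namespace IsHalfWave

variable {R u : ℝ → ℝ} {x₀ x₁ : ℝ}

theorem strictMonoOn (W : IsHalfWave R u x₀ x₁) (hu : Continuous u) :
    StrictMonoOn u (Icc x₀ x₁) :=
  strictMonoOn_of_deriv_pos (convex_Icc _ _) hu.continuousOn
    (fun x hx => by rw [interior_Icc] at hx; exact W.deriv_pos x hx)

theorem image_Ioo (W : IsHalfWave R u x₀ x₁) (hu : Continuous u) :
    u '' Ioo x₀ x₁ = Ioo (u x₀) (u x₁) := by
  refine Subset.antisymm ?_ (intermediate_value_Ioo W.lt.le hu.continuousOn)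
  rintro _ ⟨x, hx, rfl⟩
  have hm := W.strictMonoOn hu
  exact ⟨hm ⟨le_rfl, W.lt.le⟩ (Ioo_subset_Icc_self hx) hx.1,
    hm (Ioo_subset_Icc_self hx) ⟨W.lt.le, le_rfl⟩ hx.2⟩

theorem mem_range (W : IsHalfWave R u x₀ x₁) (hu : Continuous u) (x : ℝ) :
    u x ∈ Icc (u x₀) (u x₁) := by
  have hm := (W.strictMonoOn hu).monotoneOn
  have hT : 0 < 2 * (x₁ - x₀) := by linarith [W.lt]
  obtain ⟨y, hy, hxy⟩ := W.periodic.exists_mem_Ico hT x x₀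
  rw [hxy]
  have key : ∀ z ∈ Icc x₀ x₁, u z ∈ Icc (u x₀) (u x₁) := fun z hz =>
    ⟨hm ⟨le_rfl, W.lt.le⟩ hz hz.1, hm hz ⟨W.lt.le, le_rfl⟩ hz.2⟩
  rcases le_total y x₁ with h | h
  · exact key y ⟨hy.1, h⟩
  · rw [← W.reflect_left y, ← W.periodic (2 * x₀ - y)]
    exact key _ ⟨by linarith [hy.2], by linarith⟩

theorem interior_range (W : IsHalfWave R u x₀ x₁) (hu : Continuous u) :
    interior (range u) = Ioo (u x₀) (u x₁) := by
  have : range u = Icc (u x₀) (u x₁) := by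
    refine Subset.antisymm (range_subset_iff.2 (W.mem_range hu)) ?_
    exact (intermediate_value_Icc W.lt.le hu.continuousOn).trans (image_subset_range _ _)
  rw [this, interior_Icc]

theorem gap_pos (W : IsHalfWave R u x₀ x₁) (hu : Continuous u)
    (henergy : ∀ x, deriv u x ^ 2 / 2 = R (u x)) {v : ℝ} (hv : v ∈ Ioo (u x₀) (u x₁)) :
    0 < R v := by
  rw [← W.image_Ioo hu] at hv
  obtain ⟨x, hx, rfl⟩ := hv
  rw [← henergy]
  have := W.deriv_pos x hx
  positivity

theorem connectedComponentIn_eq (W : IsHalfWave R u x₀ x₁) (hu : Continuous u)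
    (henergy : ∀ x, deriv u x ^ 2 / 2 = R (u x)) {v₀ : ℝ} (hv₀ : v₀ ∈ Ioo (u x₀) (u x₁)) :
    connectedComponentIn {v | 0 < R v} v₀ = Ioo (u x₀) (u x₁) :=
  connectedComponentIn_pos_eq_Ioo W.gap_left W.gap_right (fun _ hv => W.gap_pos hu henergy hv) hv₀

/-- The substitution `v = u(x)`, `dv = √(2R(v)) dx`. -/
theorem setIntegral_div_sqrt (W : IsHalfWave R u x₀ x₁) (hu : Differentiable ℝ u)
    (henergy : ∀ x, deriv u x ^ 2 / 2 = R (u x)) {v₀ : ℝ} (hv₀ : v₀ ∈ Ioo (u x₀) (u x₁))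
    (G : ℝ → ℝ) :
    ∫ v in connectedComponentIn {v | 0 < R v} v₀, G v / √(2 * R v) =
      ∫ x in x₀..x₁, G (u x) := by
  rw [W.connectedComponentIn_eq hu.continuous henergy hv₀, ← W.image_Ioo hu.continuous,
    integral_image_eq_integral_abs_deriv_smul measurableSet_Ioo
      (fun x _ => (hu x).hasDerivAt.hasDerivWithinAt)
      ((W.strictMonoOn hu.continuous).injOn.mono Ioo_subset_Icc_self),
    intervalIntegral.integral_of_le W.lt.le, integral_Ioc_eq_integral_Ioo]
  refine setIntegral_congr_fun measurableSet_Ioo fun x hx => ?_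
  have h1 := W.deriv_pos x hx
  have h2 : √(2 * R (u x)) = deriv u x := by
    rw [← henergy, mul_div_cancel₀ _ (two_ne_zero' ℝ), Real.sqrt_sq h1.le]
  simp only [h2, smul_eq_mul, abs_of_pos h1]
  field_simp

theorem integral_period (W : IsHalfWave R u x₀ x₁) (hu : Continuous u) {G : ℝ → ℝ}
    (hG : Continuous G) :
    ∫ x in x₀..x₀ + 2 * (x₁ - x₀), G (u x) = 2 * ∫ x in x₀..x₁, G (u x) := by
  have hc : Continuous fun x => G (u x) := hG.comp hu
  have hrefl : ∫ x in x₁..x₀ + 2 * (x₁ - x₀), G (u x) = ∫ x in x₀..x₁, G (u x) := by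
    have h1 : ∀ x, u (2 * x₁ - x) = u x := fun x => by
      rw [← W.reflect_left x, ← W.periodic (2 * x₀ - x)]
      congr 1
      ring
    have := intervalIntegral.integral_comp_sub_left (fun x => G (u x)) (2 * x₁)
      (a := x₀) (b := x₁)
    simp_rw [h1] at this
    rw [this]
    congr 1 <;> ring
  rw [← intervalIntegral.integral_add_adjacent_intervals (hc.intervalIntegrable x₀ x₁)
    (hc.intervalIntegrable _ _), hrefl]
  ring

end IsHalfWave

/-! ### Simple turning points and the Bezout relation -/

namespace IsHalfWave

variable {R u : ℝ → ℝ} {x₀ x₁ : ℝ}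

/-- Since the turning points are simple zeros of `R`, a neighbourhood of the range of the wave is a
hump of `R`. -/
theorem exists_isHump (W : IsHalfWave R u x₀ x₁) (hR : ContDiff ℝ 2 R) (hu : Continuous u)
    (henergy : ∀ x, deriv u x ^ 2 / 2 = R (u x)) {v₀ : ℝ} (hv₀ : v₀ ∈ Ioo (u x₀) (u x₁)) :
    ∃ p₁ p₂ p₃ p₄ m, IsHump R p₁ p₂ p₃ p₄ m ∧ v₀ ∈ Icc p₂ p₃ ∧ p₁ < u x₀ ∧ u x₁ < p₄ := by
  have hR'c := (contDiff_one_deriv hR).continuous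
  have hd : Differentiable ℝ R := hR.differentiable two_ne_zero
  have hl := W.slope_left
  have hr := W.slope_right
  set m := min (deriv R (u x₀)) (-deriv R (u x₁)) / 2 with hm
  have hm0 : 0 < m := by
    have : 0 < min (deriv R (u x₀)) (-deriv R (u x₁)) := lt_min hl (by linarith)
    linarith
  have hml : m < deriv R (u x₀) := by
    have := min_le_left (deriv R (u x₀)) (-deriv R (u x₁))
    linarith
  have hmr : deriv R (u x₁) < -m := by
    have := min_le_right (deriv R (u x₀)) (-deriv R (u x₁))
    linarith
  obtain ⟨d₁, hd₁, hb₁⟩ := Metric.nhds_basis_closedBall.eventually_iff.1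
    (hR'c.continuousAt.eventually_const_lt hml)
  obtain ⟨d₂, hd₂, hb₂⟩ := Metric.nhds_basis_closedBall.eventually_iff.1
    (hR'c.continuousAt.eventually_lt_const hmr)
  set d := min (min d₁ d₂) (min (v₀ - u x₀) (u x₁ - v₀))
  have hd0 : 0 < d := lt_min (lt_min hd₁ hd₂) (lt_min (sub_pos.2 hv₀.1) (sub_pos.2 hv₀.2))
  have hdd₁ : d ≤ d₁ := (min_le_left _ _).trans (min_le_left _ _)
  have hdd₂ : d ≤ d₂ := (min_le_left _ _).trans (min_le_right _ _)
  have hdv₁ : d ≤ v₀ - u x₀ := (min_le_right _ _).trans (min_le_left _ _)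
  have hdv₂ : d ≤ u x₁ - v₀ := (min_le_right _ _).trans (min_le_right _ _)
  have hleft : ∀ v ∈ Icc (u x₀ - d) (u x₀ + d), m ≤ deriv R v := fun v hv =>
    (hb₁ (by rw [Real.closedBall_eq_Icc]; exact ⟨by linarith [hv.1], by linarith [hv.2]⟩)).le
  have hright : ∀ v ∈ Icc (u x₁ - d) (u x₁ + d), deriv R v ≤ -m := fun v hv =>
    (hb₂ (by rw [Real.closedBall_eq_Icc]; exact ⟨by linarith [hv.1], by linarith [hv.2]⟩)).le
  refine ⟨u x₀ - d, u x₀ + d, u x₁ - d, u x₁ + d, m,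
    ⟨hR.of_le one_le_two, hm0, by linarith, by linarith, by linarith, hleft, hright, ?_, ?_, ?_⟩,
    ⟨by linarith, by linarith⟩, by linarith, by linarith⟩
  · intro v hv
    exact W.gap_pos hu henergy ⟨by linarith [hv.1], by linarith [hv.2]⟩
  · have := (convex_Icc (u x₀ - d) (u x₀ + d)).mul_sub_le_image_sub_of_le_deriv
      hd.continuous.continuousOn hd.differentiableOn
      (fun v hv => hleft v (interior_subset hv)) (u x₀ - d) ⟨le_rfl, by linarith⟩ (u x₀)
      ⟨by linarith, by linarith⟩ (by linarith)
    rw [W.gap_left] at this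
    nlinarith
  · have := (convex_Icc (u x₁ - d) (u x₁ + d)).image_sub_le_mul_sub_of_deriv_le
      hd.continuous.continuousOn hd.differentiableOn
      (fun v hv => hright v (interior_subset hv)) (u x₁) ⟨by linarith, by linarith⟩ (u x₁ + d)
      ⟨by linarith, le_rfl⟩ (by linarith)
    rw [W.gap_right] at this
    nlinarith

end IsHalfWave

/-- `R` and `R'` have no common zero on a hump, so they satisfy a Bezout relation there. -/
theorem IsHump.exists_bezout {R : ℝ → ℝ} {p₁ p₂ p₃ p₄ m : ℝ} (H : IsHump R p₁ p₂ p₃ p₄ m)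
    (hR : ContDiff ℝ 2 R) :
    ∃ α β : ℝ → ℝ, ContDiff ℝ 1 α ∧ ContDiff ℝ 1 β ∧
      ∀ v ∈ Icc p₁ p₄, α v * deriv R v + β v * R v = 1 := by
  have hR1 : ContDiff ℝ 1 R := hR.of_le one_le_two
  have hR' := contDiff_one_deriv hR
  -- The last two terms vanish on `[p₁, p₄]` and keep the denominator positive elsewhere.
  set D : ℝ → ℝ := fun v => deriv R v ^ 2 + R v ^ 2 + (expNegInvGlue (v - p₄) +
    expNegInvGlue (p₁ - v)) with hD
  have hDc : ContDiff ℝ 1 D := by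
    have h := expNegInvGlue.contDiff (n := 1)
    exact ((hR'.pow 2).add (hR1.pow 2)).add ((h.comp (contDiff_id.sub contDiff_const)).add
      (h.comp (contDiff_const.sub contDiff_id)))
  have hDpos : ∀ v, D v ≠ 0 := by
    intro v
    have h1 := expNegInvGlue.nonneg (v - p₄)
    have h2 := expNegInvGlue.nonneg (p₁ - v)
    have hm := H.slope_pos
    refine ne_of_gt ?_
    simp only [hD]
    rcases lt_or_ge v p₁ with h | h
    · have := expNegInvGlue.pos_of_pos (sub_pos.2 h)
      positivity
    rcases lt_or_ge p₄ v with h' | h'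
    · have := expNegInvGlue.pos_of_pos (sub_pos.2 h')
      positivity
    rcases le_total v p₂ with h₂ | h₂
    · have := hm.trans_le (H.left v ⟨h, h₂⟩)
      positivity
    rcases le_total v p₃ with h₃ | h₃
    · have := H.mid v ⟨h₂, h₃⟩
      positivity
    · have := H.right v ⟨h₃, h'⟩
      have : deriv R v ≠ 0 := by linarith
      positivity
  refine ⟨fun v => deriv R v / D v, fun v => R v / D v, hR'.div hDc hDpos, hR1.div hDc hDpos, ?_⟩
  intro v hv
  have hDv : D v = deriv R v ^ 2 + R v ^ 2 := by
    simp only [hD]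
    rw [expNegInvGlue.zero_of_nonpos (sub_nonpos.2 hv.2),
      expNegInvGlue.zero_of_nonpos (sub_nonpos.2 hv.1), add_zero, add_zero]
  have hne := hDpos v
  field_simp
  rw [hDv]

/-! ### Solutions of the linearized equation -/

/-- The integrand, along the wave, of the finite part of `∮ g (2R) ^ (-3/2)`: it differs from
`g / (2R)` by the `x`-derivative of `g α / u'`, which carries the singularity. -/
noncomputable def finitePartDensity (α β g : ℝ → ℝ) (v : ℝ) : ℝ :=
  deriv (fun v => g v * α v) v + g v * β v / 2

/-- The variation of the wave with respect to a parameter on which `R` depends through the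
coefficient of `g`: formally `u' ∫ g(u) / u'²`, regularized at the turning points by means of
the Bezout relation `α R' + β R = 1`. For `g = 1` and `g = v` these are `u_E` and `u_a`. -/
noncomputable def variationSolution (α β g u : ℝ → ℝ) (x₀ x : ℝ) : ℝ :=
  -(g (u x) * α (u x)) + deriv u x * ∫ s in x₀..x, finitePartDensity α β g (u s)

theorem continuous_finitePartDensity {α β g : ℝ → ℝ} (hα : ContDiff ℝ 1 α) (hβ : ContDiff ℝ 1 β)
    (hg : ContDiff ℝ 1 g) : Continuous (finitePartDensity α β g) :=
  ((hg.mul hα).continuous_deriv le_rfl).add ((hg.continuous.mul hβ.continuous).div_const 2)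

theorem finitePartDensity_id_mul {α β g : ℝ → ℝ} (hα : ContDiff ℝ 1 α) (hg : ContDiff ℝ 1 g)
    (v : ℝ) : finitePartDensity α β (fun v => v * g v) v =
      g v * α v + v * finitePartDensity α β g v := by
  have h1 := ((hasDerivAt_id v).mul
    ((hg.mul hα).differentiable one_ne_zero v).hasDerivAt).deriv
  have h2 : (id * fun v => g v * α v) = fun v => v * g v * α v := by
    funext w
    simp [mul_assoc]
  rw [h2] at h1
  simp only [finitePartDensity, h1, id]
  ring

section Variation

variable {R u α β g : ℝ → ℝ} {x₀ p₁ p₄ : ℝ}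

/-- A solution of `u'' = R'(u)`, `u'² = 2 R(u)` with a Bezout relation between `R` and `R'`. The
relation holds on a neighbourhood `[p₁, p₄]` of the range of `u`, so it may be differentiated
at `u x`. -/
structure IsWaveWithBezout (R u α β : ℝ → ℝ) (p₁ p₄ : ℝ) : Prop where
  contDiff_gap : ContDiff ℝ 2 R
  contDiff_wave : ContDiff ℝ 2 u
  energy : ∀ x, deriv u x ^ 2 / 2 = R (u x)
  profile : ∀ x, deriv (deriv u) x = deriv R (u x)
  contDiff_left : ContDiff ℝ 1 α
  contDiff_right : ContDiff ℝ 1 β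
  range_mem : ∀ x, u x ∈ Ioo p₁ p₄
  bezout : ∀ v ∈ Icc p₁ p₄, α v * deriv R v + β v * R v = 1

namespace IsWaveWithBezout

theorem hasDerivAt_primitive (B : IsWaveWithBezout R u α β p₁ p₄)
    (hg : ContDiff ℝ 1 g) (x : ℝ) :
    HasDerivAt (fun x => ∫ s in x₀..x, finitePartDensity α β g (u s))
      (finitePartDensity α β g (u x)) x := by
  have hc : Continuous fun s => finitePartDensity α β g (u s) :=
    (continuous_finitePartDensity B.contDiff_left B.contDiff_right hg).comp
      B.contDiff_wave.continuous
  exact intervalIntegral.integral_hasDerivAt_right (hc.intervalIntegrable _ _)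
    (hc.stronglyMeasurableAtFilter _ _) hc.continuousAt

theorem hasDerivAt_wave (B : IsWaveWithBezout R u α β p₁ p₄)
    (x : ℝ) : HasDerivAt u (deriv u x) x :=
  (B.contDiff_wave.differentiable two_ne_zero x).hasDerivAt

theorem hasDerivAt_deriv_wave (B : IsWaveWithBezout R u α β p₁ p₄)
    (x : ℝ) : HasDerivAt (deriv u) (deriv R (u x)) x := by
  have := ((contDiff_one_deriv B.contDiff_wave).differentiable one_ne_zero x).hasDerivAt
  rwa [B.profile] at this

theorem hasDerivAt_variationSolution (B : IsWaveWithBezout R u α β p₁ p₄)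
    (hg : ContDiff ℝ 1 g) (x : ℝ) :
    HasDerivAt (variationSolution α β g u x₀)
      (deriv R (u x) * (∫ s in x₀..x, finitePartDensity α β g (u s)) +
        deriv u x * (g (u x) * β (u x)) / 2) x := by
  have h1 : HasDerivAt (fun x => g (u x) * α (u x))
      (deriv (fun v => g v * α v) (u x) * deriv u x) x :=
    HasDerivAt.comp x ((hg.mul B.contDiff_left).differentiable one_ne_zero (u x)).hasDerivAt
      (B.hasDerivAt_wave x)
  refine (h1.neg.add ((B.hasDerivAt_deriv_wave x).mul
    (B.hasDerivAt_primitive hg x))).congr_deriv ?_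
  simp only [finitePartDensity]
  ring

theorem deriv_variationSolution (B : IsWaveWithBezout R u α β p₁ p₄)
    (hg : ContDiff ℝ 1 g) :
    deriv (variationSolution α β g u x₀) = fun x =>
      deriv R (u x) * (∫ s in x₀..x, finitePartDensity α β g (u s)) +
        deriv u x * (g (u x) * β (u x)) / 2 :=
  funext fun x => (B.hasDerivAt_variationSolution hg x).deriv

theorem contDiff_variationSolution (B : IsWaveWithBezout R u α β p₁ p₄)
    (hg : ContDiff ℝ 1 g) :
    ContDiff ℝ 2 (variationSolution α β g u x₀) := by
  have hu1 : ContDiff ℝ 1 u := B.contDiff_wave.of_le one_le_two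
  have hc : Continuous fun s => finitePartDensity α β g (u s) :=
    (continuous_finitePartDensity B.contDiff_left B.contDiff_right hg).comp hu1.continuous
  have hprim : ContDiff ℝ 1 fun x => ∫ s in x₀..x, finitePartDensity α β g (u s) := by
    rw [contDiff_one_iff_deriv]
    refine ⟨fun x => (B.hasDerivAt_primitive hg x).differentiableAt, ?_⟩
    rwa [show deriv (fun x => ∫ s in x₀..x, finitePartDensity α β g (u s)) =
      fun x => finitePartDensity α β g (u x) from
      funext fun x => (B.hasDerivAt_primitive hg x).deriv]
  suffices ContDiff ℝ (1 + 1) (variationSolution α β g u x₀) from this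
  rw [contDiff_succ_iff_deriv]
  refine ⟨fun x => (B.hasDerivAt_variationSolution hg x).differentiableAt, by simp, ?_⟩
  rw [B.deriv_variationSolution hg]
  exact (((contDiff_one_deriv B.contDiff_gap).comp hu1).mul hprim).add
    (((contDiff_one_deriv B.contDiff_wave).mul
      ((hg.comp hu1).mul (B.contDiff_right.comp hu1))).div_const 2)

/-- `variationSolution` solves the linearized equation `-y'' + R''(u) y = -g'(u)`. This is the
derivative of the relation `g α R' + g β R = g`. -/
theorem linearized_variationSolution (B : IsWaveWithBezout R u α β p₁ p₄)
    (hg : ContDiff ℝ 1 g) (x : ℝ) :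
    -deriv (deriv (variationSolution α β g u x₀)) x +
      deriv (deriv R) (u x) * variationSolution α β g u x₀ x = -deriv g (u x) := by
  have hα := B.contDiff_left
  have hβ := B.contDiff_right
  have hR1 : ContDiff ℝ 1 R := B.contDiff_gap.of_le one_le_two
  have hR'd := ((contDiff_one_deriv B.contDiff_gap).differentiable one_ne_zero (u x)).hasDerivAt
  have hgβ := ((hg.mul hβ).differentiable one_ne_zero (u x)).hasDerivAt
  have hgα := ((hg.mul hα).differentiable one_ne_zero (u x)).hasDerivAt
  have hrel : deriv (fun v => g v * α v) (u x) * deriv R (u x) +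
      g (u x) * α (u x) * deriv (deriv R) (u x) +
      (deriv (fun v => g v * β v) (u x) * R (u x) + g (u x) * β (u x) * deriv R (u x)) =
      deriv g (u x) := by
    have h1 := (hgα.mul hR'd).add (hgβ.mul (hR1.differentiable one_ne_zero (u x)).hasDerivAt)
    refine h1.unique ((hg.differentiable one_ne_zero (u x)).hasDerivAt.congr_of_eventuallyEq ?_)
    filter_upwards [Ioo_mem_nhds (B.range_mem x).1 (B.range_mem x).2] with v hv
    have := B.bezout v (Ioo_subset_Icc_self hv)
    simp only [Pi.add_apply, Pi.mul_apply]
    linear_combination g v * this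
  have h2 : HasDerivAt (fun x => deriv R (u x)) (deriv (deriv R) (u x) * deriv u x) x :=
    HasDerivAt.comp x hR'd (B.hasDerivAt_wave x)
  have h3 : HasDerivAt (fun x => g (u x) * β (u x))
      (deriv (fun v => g v * β v) (u x) * deriv u x) x :=
    HasDerivAt.comp x hgβ (B.hasDerivAt_wave x)
  have h4 := (h2.mul (B.hasDerivAt_primitive (x₀ := x₀) hg x)).add
    (((B.hasDerivAt_deriv_wave x).mul h3).div_const 2)
  rw [B.deriv_variationSolution hg]
  have h5 := h4.deriv
  have henergy := B.energy x
  refine (congrArg (fun t => -t + _) h5).trans ?_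
  simp only [variationSolution, finitePartDensity] at *
  linear_combination -hrel - deriv (fun v => g v * β v) (u x) * henergy

theorem variationSolution_add_period (B : IsWaveWithBezout R u α β p₁ p₄)
    (hg : ContDiff ℝ 1 g) {T : ℝ} (hT : Function.Periodic u T)
    (x : ℝ) : variationSolution α β g u x₀ (x + T) = variationSolution α β g u x₀ x +
      deriv u x * ∫ s in x₀..x₀ + T, finitePartDensity α β g (u s) := by
  have hc : Continuous fun s => finitePartDensity α β g (u s) :=
    (continuous_finitePartDensity B.contDiff_left B.contDiff_right hg).comp
      B.contDiff_wave.continuous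
  have hd : deriv u (x + T) = deriv u x := by
    rw [← deriv_comp_add_const]
    congr 1
    funext y
    exact hT y
  have hper : Function.Periodic (fun s => finitePartDensity α β g (u s)) T := fun s => by
    simp only [hT s]
  rw [variationSolution, variationSolution, hT, hd, ← hper.intervalIntegral_add_eq x x₀,
    ← intervalIntegral.integral_add_adjacent_intervals (hc.intervalIntegrable x₀ x)
      (hc.intervalIntegrable x (x + T))]
  ring

theorem integral_variationSolution (B : IsWaveWithBezout R u α β p₁ p₄)
    (hg : ContDiff ℝ 1 g) {T : ℝ} (hT : Function.Periodic u T) :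
    ∫ x in x₀..x₀ + T, variationSolution α β g u x₀ x =
      u x₀ * (∫ x in x₀..x₀ + T, finitePartDensity α β g (u x)) -
        ∫ x in x₀..x₀ + T, finitePartDensity α β (fun v => v * g v) (u x) := by
  have huc := B.contDiff_wave.continuous
  have hu'c := (contDiff_one_deriv B.contDiff_wave).continuous
  have hαc := B.contDiff_left.continuous
  have hgc := hg.continuous
  have hc : Continuous fun s => finitePartDensity α β g (u s) :=
    (continuous_finitePartDensity B.contDiff_left B.contDiff_right hg).comp huc
  have hibp := intervalIntegral.integral_mul_deriv_eq_deriv_mul_of_hasDerivAt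
    (a := x₀) (b := x₀ + T)
    (u := fun x => ∫ s in x₀..x, finitePartDensity α β g (u s)) (v := u)
    (continuous_iff_continuousAt.2 fun x =>
      (B.hasDerivAt_primitive hg x).continuousAt).continuousOn huc.continuousOn
    (fun x _ => B.hasDerivAt_primitive hg x) (fun x _ => B.hasDerivAt_wave x)
    (hc.intervalIntegrable _ _) (hu'c.intervalIntegrable _ _)
  rw [intervalIntegral.integral_same, zero_mul, sub_zero, hT] at hibp
  have hprimc : Continuous fun x => ∫ s in x₀..x, finitePartDensity α β g (u s) :=
    continuous_iff_continuousAt.2 fun x => (B.hasDerivAt_primitive hg x).continuousAt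
  have hi₁ : IntervalIntegrable (fun x => g (u x) * α (u x)) volume x₀ (x₀ + T) :=
    Continuous.intervalIntegrable (by fun_prop) _ _
  have hi₂ : IntervalIntegrable (fun x => (∫ s in x₀..x, finitePartDensity α β g (u s)) *
      deriv u x) volume x₀ (x₀ + T) := (hprimc.mul hu'c).intervalIntegrable _ _
  have hi₃ : IntervalIntegrable (fun x => finitePartDensity α β g (u x) * u x) volume
      x₀ (x₀ + T) := (hc.mul huc).intervalIntegrable _ _
  have h1 : ∫ x in x₀..x₀ + T, variationSolution α β g u x₀ x =
      (∫ x in x₀..x₀ + T, (∫ s in x₀..x, finitePartDensity α β g (u s)) * deriv u x) -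
        ∫ x in x₀..x₀ + T, g (u x) * α (u x) := by
    rw [← intervalIntegral.integral_sub hi₂ hi₁]
    refine intervalIntegral.integral_congr fun x _ => ?_
    simp only [variationSolution]
    ring
  have h2 : ∫ x in x₀..x₀ + T, finitePartDensity α β (fun v => v * g v) (u x) =
      (∫ x in x₀..x₀ + T, g (u x) * α (u x)) +
        ∫ x in x₀..x₀ + T, finitePartDensity α β g (u x) * u x := by
    rw [← intervalIntegral.integral_add hi₁ hi₃]
    refine intervalIntegral.integral_congr fun x _ => ?_
    simp only [finitePartDensity_id_mul B.contDiff_left hg]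
    ring
  rw [h1, h2, hibp]
  ring

end IsWaveWithBezout

end Variation

/-! ### Parameter derivatives of period and mass -/

theorem hasDerivAt_energyGap {f F : ℝ → ℝ} (hF : ∀ v, HasDerivAt F (f v) v) (a E c v : ℝ) :
    HasDerivAt (energyGap F a E c) (a + c * v - f v) v := by
  have h1 : HasDerivAt (fun v => c / 2 * v ^ 2) (c / 2 * (2 * v)) v := by
    simpa using (hasDerivAt_pow 2 v).const_mul (c / 2)
  have h2 := ((((hasDerivAt_id v).const_mul a).const_add E).add h1).sub (hF v)
  exact h2.congr_deriv (by ring)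

theorem deriv_energyGap {f F : ℝ → ℝ} (hF : ∀ v, HasDerivAt F (f v) v) (a E c : ℝ) :
    deriv (energyGap F a E c) = fun v => a + c * v - f v :=
  funext fun v => (hasDerivAt_energyGap hF a E c v).deriv

theorem contDiff_energyGap {f F : ℝ → ℝ} (hf : ContDiff ℝ 2 f)
    (hF : ∀ v, HasDerivAt F (f v) v) (a E c : ℝ) : ContDiff ℝ 2 (energyGap F a E c) := by
  suffices ContDiff ℝ (1 + 1) (energyGap F a E c) from this
  rw [contDiff_succ_iff_deriv, deriv_energyGap hF]
  refine ⟨fun v => (hasDerivAt_energyGap hF a E c v).differentiableAt, by simp, ?_⟩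
  exact (contDiff_const.add (contDiff_const.mul contDiff_id)).sub (hf.of_le one_le_two)

/-- The finite part of `-∮ g (2R) ^ (-3/2)`, as an integral over one period of the wave. -/
noncomputable def finitePart (α β u : ℝ → ℝ) (x₀ x₁ : ℝ) (g : ℝ → ℝ) : ℝ :=
  -∫ x in x₀..x₀ + 2 * (x₁ - x₀), finitePartDensity α β g (u x)

section Parameters

variable {F u α β h : ℝ → ℝ} {a E c v₀ x₀ x₁ p₁ p₂ p₃ p₄ m : ℝ}

theorem hasDerivAt_loop_integral_wave
    (B : IsWaveWithBezout (energyGap F a E c) u α β p₁ p₄)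
    (W : IsHalfWave (energyGap F a E c) u x₀ x₁)
    (H : IsHump (energyGap F a E c) p₁ p₂ p₃ p₄ m) (hv₀ : v₀ ∈ Ioo (u x₀) (u x₁))
    (hv₀' : v₀ ∈ Icc p₂ p₃) {p : ℝ → ℝ} (hp : ContDiff ℝ 2 p) (hh : ContDiff ℝ 1 h) :
    HasDerivAt (fun e => 2 * ∫ v in connectedComponentIn {v | 0 < energyGap F a E c v + e * p v} v₀,
        h v / √(2 * (energyGap F a E c v + e * p v)))
      (finitePart α β u x₀ x₁ fun v => p v * h v) 0 := by
  have h1 := (H.hasDerivAt_loop_integral hv₀' hp B.contDiff_left B.contDiff_right B.bezout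
    hh).const_mul 2
  refine h1.congr_deriv ?_
  have huc := B.contDiff_wave.continuous
  rw [finitePart, W.integral_period huc (continuous_finitePartDensity B.contDiff_left
    B.contDiff_right ((hp.of_le one_le_two).mul hh)), mul_neg]
  congr 2
  exact W.setIntegral_div_sqrt (B.contDiff_wave.differentiable two_ne_zero) B.energy hv₀ _

theorem hasDerivAt_loop_integral_E
    (B : IsWaveWithBezout (energyGap F a E c) u α β p₁ p₄)
    (W : IsHalfWave (energyGap F a E c) u x₀ x₁)
    (H : IsHump (energyGap F a E c) p₁ p₂ p₃ p₄ m) (hv₀ : v₀ ∈ Ioo (u x₀) (u x₁))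
    (hv₀' : v₀ ∈ Icc p₂ p₃) (hh : ContDiff ℝ 1 h) :
    HasDerivAt (fun E' => 2 * ∫ v in orbitInterval F v₀ a E' c, h v / √(2 * energyGap F a E' c v))
      (finitePart α β u x₀ x₁ h) E := by
  have h1 := hasDerivAt_loop_integral_wave B W H hv₀ hv₀' (p := fun _ => 1) contDiff_const hh
  have h2 := HasDerivAt.comp_sub_const E E (by rw [sub_self]; exact h1)
  have hgap : ∀ E' v, energyGap F a E c v + (E' - E) * 1 = energyGap F a E' c v := fun E' v => by
    simp only [energyGap]
    ring
  simp only [hgap, one_mul] at h2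
  exact h2

theorem hasDerivAt_loop_integral_a
    (B : IsWaveWithBezout (energyGap F a E c) u α β p₁ p₄)
    (W : IsHalfWave (energyGap F a E c) u x₀ x₁)
    (H : IsHump (energyGap F a E c) p₁ p₂ p₃ p₄ m) (hv₀ : v₀ ∈ Ioo (u x₀) (u x₁))
    (hv₀' : v₀ ∈ Icc p₂ p₃) (hh : ContDiff ℝ 1 h) :
    HasDerivAt (fun a' => 2 * ∫ v in orbitInterval F v₀ a' E c, h v / √(2 * energyGap F a' E c v))
      (finitePart α β u x₀ x₁ fun v => v * h v) a := by
  have h1 := hasDerivAt_loop_integral_wave B W H hv₀ hv₀' (p := fun v => v) contDiff_id hh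
  have h2 := HasDerivAt.comp_sub_const a a (by rw [sub_self]; exact h1)
  have hgap : ∀ a' v, energyGap F a E c v + (a' - a) * v = energyGap F a' E c v := fun a' v => by
    simp only [energyGap]
    ring
  simp only [hgap] at h2
  exact h2

end Parameters

/-! ### The index theorem -/

theorem mainTheorem5 (f F u : ℝ → ℝ) (a E c : ℝ) (hf : ContDiff ℝ 2 f)
    (hu : IsPeriodicWave f F a E c u)
    (v₀ : ℝ) (hv₀ : v₀ ∈ interior (Set.range u))
    (k : ℕ) (hk : 1 ≤ k) (ℓ : ℝ) (hℓ : ℓ = k * wavePeriod F v₀ a E c)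
    (hTM : periodMassJacobian F v₀ a E c ≠ 0) :
    negIndex (linearizedOperator hf hu.contDiff c ℓ) ⊤ ≠ ⊤ ∧
    (0 < periodDerivE F v₀ a E c * periodMassJacobian F v₀ a E c →
      negIndex (linearizedOperator hf hu.contDiff c ℓ) (meanZero ℓ) =
        negIndex (linearizedOperator hf hu.contDiff c ℓ) ⊤) ∧
    (periodDerivE F v₀ a E c * periodMassJacobian F v₀ a E c < 0 →
      negIndex (linearizedOperator hf hu.contDiff c ℓ) (meanZero ℓ) + 1 =
        negIndex (linearizedOperator hf hu.contDiff c ℓ) ⊤) := by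
  set R := energyGap F a E c
  have hR : ContDiff ℝ 2 R := contDiff_energyGap hf hu.antideriv a E c
  have hR' : deriv R = fun v => a + c * v - f v := deriv_energyGap hu.antideriv a E c
  have huc := hu.contDiff.continuous
  have hud : Differentiable ℝ u := hu.contDiff.differentiable two_ne_zero
  have henergy : ∀ x, deriv u x ^ 2 / 2 = R (u x) := hu.energy
  have hprofile : ∀ x, deriv (deriv u) x = deriv R (u x) := fun x => by
    rw [hu.profile, hR']
  obtain ⟨x₀, x₁, W⟩ := exists_isHalfWave hR hu.contDiff henergy hprofile hu.periodic hu.nonconst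
  rw [W.interior_range huc] at hv₀
  obtain ⟨p₁, p₂, p₃, p₄, m, H, hv₀', hp₁, hp₄⟩ := W.exists_isHump hR huc henergy hv₀
  obtain ⟨α, β, hα, hβ, hbez⟩ := H.exists_bezout hR
  have B : IsWaveWithBezout R u α β p₁ p₄ := ⟨hR, hu.contDiff, henergy, hprofile, hα, hβ,
    fun x => ⟨hp₁.trans_le (W.mem_range huc x).1, (W.mem_range huc x).2.trans_lt hp₄⟩, hbez⟩
  set J := finitePart α β u x₀ x₁ with hJ
  have hTE : HasDerivAt (fun E' => wavePeriod F v₀ a E' c) (J fun _ => 1) E :=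
    hasDerivAt_loop_integral_E B W H hv₀ hv₀' contDiff_const
  have hTa : HasDerivAt (fun a' => wavePeriod F v₀ a' E c) (J fun v => v * 1) a :=
    hasDerivAt_loop_integral_a B W H hv₀ hv₀' contDiff_const
  have hME : HasDerivAt (fun E' => waveMass F v₀ a E' c) (J fun v => v) E :=
    hasDerivAt_loop_integral_E B W H hv₀ hv₀' contDiff_id
  have hMa : HasDerivAt (fun a' => waveMass F v₀ a' E c) (J fun v => v * v) a :=
    hasDerivAt_loop_integral_a B W H hv₀ hv₀' contDiff_id
  simp only [mul_one] at hTa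
  have hdE : periodDerivE F v₀ a E c = J fun _ => 1 := hTE.deriv
  have hjac : periodMassJacobian F v₀ a E c =
      (J fun v => v) * (J fun v => v) - (J fun _ => 1) * (J fun v => v * v) := by
    rw [periodMassJacobian, jacobian₂, hTa.deriv, hME.deriv, hTE.deriv, hMa.deriv]
  have hT : wavePeriod F v₀ a E c = 2 * (x₁ - x₀) := by
    have := W.setIntegral_div_sqrt hud henergy hv₀ fun _ => 1
    rw [wavePeriod, orbitInterval, this]
    simp
  set T := 2 * (x₁ - x₀)
  have hT0 : 0 < T := by linarith [W.lt]
  have hk0 : (0 : ℝ) < k := by exact_mod_cast hk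
  have hℓ0 : 0 < ℓ := by rw [hℓ, hT]; positivity
  -- The combination `T_a u_E - T_E u_a`, in which the secular terms cancel.
  set ψ : ℝ → ℝ := fun x => (J fun v => v) * variationSolution α β (fun _ => 1) u x₀ x -
    (J fun _ => 1) * variationSolution α β (fun v => v) u x₀ x with hψ
  have hg₁ : ContDiff ℝ 1 (fun _ : ℝ => (1 : ℝ)) := contDiff_const
  have hg₂ : ContDiff ℝ 1 (fun v : ℝ => v) := contDiff_id
  have hy₁ : ContDiff ℝ 2 (variationSolution α β (fun _ => 1) u x₀) :=
    B.contDiff_variationSolution hg₁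
  have hy₂ : ContDiff ℝ 2 (variationSolution α β (fun v => v) u x₀) :=
    B.contDiff_variationSolution hg₂
  have hψ2 : ContDiff ℝ 2 ψ := (contDiff_const.mul hy₁).sub (contDiff_const.mul hy₂)
  have hJint : ∀ g, ∫ s in x₀..x₀ + T, finitePartDensity α β g (u s) = -J g := fun g => by
    rw [hJ, finitePart, neg_neg]
  have hψT : Function.Periodic ψ T := by
    intro x
    simp only [hψ]
    rw [B.variationSolution_add_period hg₁ W.periodic, B.variationSolution_add_period hg₂
      W.periodic, hJint, hJint]
    ring
  have hψℓ : Function.Periodic ψ ℓ := by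
    rw [hℓ, hT]
    exact hψT.nat_mul k
  have hψint : ∫ x in 0..ℓ, ψ x = k * periodMassJacobian F v₀ a E c := by
    have h1 := hψT.intervalIntegral_add_zsmul_eq k 0
      (fun _ _ => hψ2.continuous.intervalIntegrable _ _)
    rw [hψT.intervalIntegral_add_eq 0 x₀] at h1
    simp only [zero_add, zsmul_eq_mul, Int.cast_natCast] at h1
    have h2 : ∫ x in x₀..x₀ + T, ψ x = periodMassJacobian F v₀ a E c := by
      simp only [hψ]
      rw [intervalIntegral.integral_sub ((hy₁.continuous.const_mul _).intervalIntegrable _ _)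
        ((hy₂.continuous.const_mul _).intervalIntegrable _ _),
        intervalIntegral.integral_const_mul, intervalIntegral.integral_const_mul,
        B.integral_variationSolution hg₁ W.periodic, B.integral_variationSolution hg₂ W.periodic,
        hJint, hJint, hJint, hJint, hjac]
      simp only [mul_one]
      ring
    rw [hℓ, hT, h1, h2]
  set V : C(ℝ, ℝ) := ⟨fun x => -deriv f (u x) + c,
    ((hf.continuous_deriv one_le_two).comp hu.contDiff.continuous).neg.add continuous_const⟩
  have hR'' : ∀ v, deriv (deriv R) v = -deriv f v + c := by
    intro v
    rw [hR']
    have := (((hasDerivAt_id v).const_mul c).const_add a).sub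
      (hf.differentiable two_ne_zero v).hasDerivAt
    exact (this.congr_deriv (by ring)).deriv
  have heq : ∀ x, -deriv (deriv ψ) x + V x * ψ x = periodDerivE F v₀ a E c := by
    intro x
    have hd : deriv ψ = fun x =>
        (J fun v => v) * deriv (variationSolution α β (fun _ => 1) u x₀) x -
        (J fun _ => 1) * deriv (variationSolution α β (fun v => v) u x₀) x := by
      funext y
      exact (((hy₁.differentiable two_ne_zero y).hasDerivAt.const_mul _).sub
        ((hy₂.differentiable two_ne_zero y).hasDerivAt.const_mul _)).deriv
    have hdd : deriv (deriv ψ) x =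
        (J fun v => v) * deriv (deriv (variationSolution α β (fun _ => 1) u x₀)) x -
        (J fun _ => 1) * deriv (deriv (variationSolution α β (fun v => v) u x₀)) x := by
      rw [hd]
      exact ((((contDiff_one_deriv hy₁).differentiable one_ne_zero x).hasDerivAt.const_mul _).sub
        (((contDiff_one_deriv hy₂).differentiable one_ne_zero x).hasDerivAt.const_mul _)).deriv
    have e₁ := B.linearized_variationSolution (x₀ := x₀) hg₁ x
    have e₂ := B.linearized_variationSolution (x₀ := x₀) hg₂ x
    rw [hR''] at e₁ e₂
    rw [deriv_const] at e₁
    rw [deriv_id''] at e₂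
    have hVx : V x = -deriv f (u x) + c := rfl
    rw [hdd, hVx, hdE]
    simp only [hψ]
    linear_combination (J fun v => v) * e₁ - (J fun _ => 1) * e₂
  have hmain := negIndex_meanZero V hℓ0 hψℓ hψ2 heq
  rw [hψint] at hmain
  refine ⟨negIndex_schrodingerOperator_ne_top V hℓ0, fun h => hmain.1 ?_, fun h => hmain.2 ?_⟩
  · rw [mul_left_comm]
    exact mul_pos hk0 h
  · rw [mul_left_comm]
    exact mul_neg_of_pos_of_neg hk0 h
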